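/- Let $[N]=\{1,\dots,N\}$ and let $\mathcal U$ be the uniform distribution on $[N]$. For a distribution $\mathcal D$ on $[N]$ with $D(i)=\Pr_{x\sim\mathcal D}[x=i]$, let $d_{\mathrm{TV}}(\mathcal D,\mathcal U)=\frac12\sum_{i=1}^N|D(i)-\frac1N|$. A conditional query names a set $S\subseteq[N]$ with $D(S)>0$ and receives a fresh independent element $i\in S$ with probability $D(i)/D(S)$. In the COND model every such query is allowed; in the PAIRCOND model only $\textsc{Samp}()$ (the case $S=[N]$) and $\textsc{Pcond}(x,y)$ (the case $S=\{x,y\}$ with $x\ne y$) are allowed. Theorem. There are a randomized adaptive algorithm TolerantUnif in the PAIRCOND model (hence also in the COND model), and absolute constants $C$ and $k$, such that for every $N\ge1$ and every $0<\varepsilon\le1$, given $N$ and $\varepsilon$ and query access to an arbitrary unknown distribution $\mathcal D$ on $[N]$, the algorithm makes at most $C\,\varepsilon^{-2}(1+\log\varepsilon^{-1})^k=\tilde O(\varepsilon^{-2})$ queries in every execution (a bound that does not depend on $N$ or $\mathcal D$), never queries a set of probability $0$ under $\mathcal D$, and outputs a real number $v$ with $$\Pr\bigl[\,|v-d_{\mathrm{TV}}(\mathcal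 D,\mathcal U)|\le\varepsilon\,\bigr]\ge \tfrac23 .$$ -/

import Mathlib

open scoped ENNReal

noncomputable section

/-- An adaptive randomized algorithm with output in `α` and access to a conditional sampling oracle
for an unknown distribution on `[N]` (modelled as `Fin N`), as a finite-depth decision tree:
* `output a` halts and returns `a`;
* `unif m next` uses internal randomness: it draws `i` uniformly from `{0, …, m}` and continues with
  `next i` (this is not a query);
* `cond S next` queries the oracle on the set `S`, receives an element `i`, and continues with
  `next i`. -/
inductive CondAlg (N : ℕ) (α : Type*) : Type _
  | output (a : α) : CondAlg N α
  | unif (m : ℕ) (next : Fin (m + 1) → CondAlg N α) : CondAlg N α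
  | cond (S : Finset (Fin N)) (next : Fin N → CondAlg N α) : CondAlg N α

/-- The law of the answer of the oracle `Cond(S)` for `D`: it is `i ∈ S` with probability
`D(i) / D(S)`. The oracle is undefined when `D(S) = 0`; the value chosen here in that case is
irrelevant, because `CondAlg.Legal` forbids such queries. -/
def condOracle {N : ℕ} (D : PMF (Fin N)) (S : Finset (Fin N)) : PMF (Fin N) := by
  classical
  exact if h : ∃ i ∈ (S : Set (Fin N)), i ∈ D.support then D.filter (S : Set (Fin N)) h else D

namespace CondAlg

variable {N : ℕ} {α : Type*}

/-- The law of the output of the algorithm when the unknown distribution is `D`. All oracle answers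
and all internal random choices are independent. -/
def run (D : PMF (Fin N)) : CondAlg N α → PMF α
  | output a => PMF.pure a
  | unif m next => (PMF.uniformOfFintype (Fin (m + 1))).bind fun i => run D (next i)
  | cond S next => (condOracle D S).bind fun i => run D (next i)

/-- The worst-case number of oracle queries, over all oracle answers and all internal random
choices. -/
def queries : CondAlg N α → ℕ
  | output _ => 0
  | unif _ next => Finset.univ.sup fun i => queries (next i)
  | cond _ next => 1 + Finset.univ.sup fun i => queries (next i)

/-- The algorithm works in the PAIRCOND model: every query is either `Samp() = Cond([N])` or
`Pcond(x, y) = Cond({x, y})` for distinct `x, y ∈ [N]`. -/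
def IsPairCond : CondAlg N α → Prop
  | output _ => True
  | unif _ next => ∀ i, IsPairCond (next i)
  | cond S next =>
      (S = Finset.univ ∨ ∃ x y : Fin N, x ≠ y ∧ S = {x, y}) ∧ ∀ i, IsPairCond (next i)

/-- In no execution that has positive probability when the unknown distribution is `D` does the
algorithm make an undefined query, that is, query a set `S` with `D(S) = 0`. -/
def Legal (D : PMF (Fin N)) : CondAlg N α → Prop
  | output _ => True
  | unif _ next => ∀ i, Legal D (next i)
  | cond S next => (∃ i ∈ S, D i ≠ 0) ∧ ∀ i ∈ S, D i ≠ 0 → Legal D (next i)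

end CondAlg

/-- Total variation distance of two distributions on `[N]`. -/
def dTV {N : ℕ} (P Q : PMF (Fin N)) : ℝ :=
  1 / 2 * ∑ i, |(P i).toReal - (Q i).toReal|

end

/-! Put t = ∑ min(D i, 1/N), so that the distance to uniform is 1 - t. Fix a reference element z
with D(z) > 0. Let a be the probability that z wins the comparison `Pcond` against a sample from D,
and b the probability that a uniform element wins against z. Term by term a = N·D(z)·b
(`probSamp_eq`), so two probabilities that can be estimated by coin flips calibrate D(z) against
1/N.

Comparing x with z flips a coin with odds s = D(x)/D(z), and min(N·D(x), 1) = min(s/ρ, 1) for ρ =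
b/a; its mean over uniform x is t. Symmetrically, the odds D(z)/D(x) with ρ = a/b have truncated
mean t over x ~ D. The side with (estimated) ρ ≤ 1 is used.

Two facts bring the cost down to ε⁻² up to logarithms. First, elements with a, b ≥ t/8 carry mass at
least t/4 (`overlap_le_sum_good`). Hence the best of O(1/ε) samples, each tested by O(ε⁻¹(1 + log
ε⁻¹)) comparisons, very likely has a, b ≥ max(t, ε)/128, or its low score certifies t ≤ ε. Since a,
b ≤ 1, this gives ρ ≳ t.

Second, the mean Φ of min(s/ρ, 1) is nonlinear in the coin bias, and the plug-in estimate from n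
flips has squared error O(Φ/(ρn)). Multilevel Monte Carlo (`expect_multilevel_sq_le`) attains mean
square error O(Φ/2^K) with O((K+1)²·2^K/ρ) queries. As Φ ≲ ρ, the choice 2^K ≈ ρ/ε² gives error ε,
and ρ cancels from the cost. -/

noncomputable section

/-! ### Decision trees: composition, expectation, sure properties, failure probability. -/

namespace CondAlg

variable {N : ℕ} {α β : Type}

/-- Sequential composition. -/
def bind : CondAlg N α → (α → CondAlg N β) → CondAlg N β
  | output a, g => g a
  | unif m next, g => unif m fun i => bind (next i) g
  | cond S next, g => cond S fun i => bind (next i) g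

/-- The expectation of `f` over the output of an algorithm. -/
def expect (D : PMF (Fin N)) : CondAlg N α → (α → ℝ) → ℝ
  | output a, f => f a
  | unif m next, f => (∑ i, expect D (next i) f) / ((m : ℝ) + 1)
  | cond S next, f => ∑ i, (condOracle D S i).toReal * expect D (next i) f

/-- Every execution of positive probability makes only defined queries and ends with an output
satisfying `P`. -/
def Ensures (D : PMF (Fin N)) : CondAlg N α → (α → Prop) → Prop
  | output a, P => P a
  | unif _ next, P => ∀ i, Ensures D (next i) P
  | cond S next, P => (∃ i ∈ S, D i ≠ 0) ∧ ∀ i ∈ S, D i ≠ 0 → Ensures D (next i) P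

theorem Ensures.legal {D : PMF (Fin N)} {A : CondAlg N α} {P : α → Prop} (h : A.Ensures D P) :
    A.Legal D := by
  induction A with
  | output a => trivial
  | unif m next ih => exact fun i => ih i (h i)
  | cond S next ih => exact ⟨h.1, fun i hi hD => ih i (h.2 i hi hD)⟩

theorem Ensures.bind {D : PMF (Fin N)} {A : CondAlg N α} {P : α → Prop} (h : A.Ensures D P)
    {g : α → CondAlg N β} {R : β → Prop} (hg : ∀ x, P x → (g x).Ensures D R) :
    (A.bind g).Ensures D R := by
  induction A with
  | output a => exact hg a h
  | unif m next ih => exact fun i => ih i (h i)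
  | cond S next ih => exact ⟨h.1, fun i hi hD => ih i (h.2 i hi hD)⟩

theorem isPairCond_bind {A : CondAlg N α} (h : A.IsPairCond) {g : α → CondAlg N β}
    (hg : ∀ x, (g x).IsPairCond) : (A.bind g).IsPairCond := by
  induction A with
  | output a => exact hg a
  | unif m next ih => exact fun i => ih i (h i)
  | cond S next ih => exact ⟨h.1, fun i => ih i (h.2 i)⟩

theorem queries_bind_le {A : CondAlg N α} {g : α → CondAlg N β} {p q : ℕ} (hA : A.queries ≤ p)
    (hg : ∀ x, (g x).queries ≤ q) : (A.bind g).queries ≤ p + q := by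
  refine le_trans ?_ (Nat.add_le_add_right hA q)
  clear hA
  induction A with
  | output a => exact (hg a).trans (Nat.le_add_left _ _)
  | unif m next ih =>
    refine Finset.sup_le fun i _ => (ih i).trans (Nat.add_le_add_right ?_ q)
    exact Finset.le_sup (f := fun i => (next i).queries) (Finset.mem_univ i)
  | cond S next ih =>
    simp only [bind, queries]
    rw [add_assoc]
    refine Nat.add_le_add_left (Finset.sup_le fun i _ => (ih i).trans
      (Nat.add_le_add_right ?_ q)) 1
    exact Finset.le_sup (f := fun i => (next i).queries) (Finset.mem_univ i)

section Expect

variable (D : PMF (Fin N))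

theorem expect_bind (A : CondAlg N α) (g : α → CondAlg N β) (f : β → ℝ) :
    (A.bind g).expect D f = A.expect D fun x => (g x).expect D f := by
  induction A with
  | output a => rfl
  | unif m next ih => simp only [bind, expect, ih]
  | cond S next ih => simp only [bind, expect, ih]

theorem expect_output (a : α) (f : α → ℝ) : (output a : CondAlg N α).expect D f = f a := rfl

theorem expect_add (A : CondAlg N α) (f g : α → ℝ) :
    A.expect D (fun x => f x + g x) = A.expect D f + A.expect D g := by
  induction A with
  | output a => rfl
  | unif m next ih => simp only [expect, ih, Finset.sum_add_distrib, add_div]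
  | cond S next ih => simp only [expect, ih, mul_add, Finset.sum_add_distrib]

theorem expect_mul_left (A : CondAlg N α) (c : ℝ) (f : α → ℝ) :
    A.expect D (fun x => c * f x) = c * A.expect D f := by
  induction A with
  | output a => rfl
  | unif m next ih => simp only [expect, ih, ← Finset.mul_sum, mul_div_assoc]
  | cond S next ih => simp only [expect, ih, Finset.mul_sum, mul_left_comm]

theorem expect_mul_right (A : CondAlg N α) (c : ℝ) (f : α → ℝ) :
    A.expect D (fun x => f x * c) = A.expect D f * c := by
  simp only [mul_comm _ c, expect_mul_left]

theorem sum_toReal_pmf {ι : Type} [Fintype ι] (p : PMF ι) : ∑ i, (p i).toReal = 1 := by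
  rw [← ENNReal.toReal_sum fun i _ => p.apply_ne_top i, ← tsum_fintype (L := .unconditional _),
    p.tsum_coe, ENNReal.toReal_one]

theorem expect_const (A : CondAlg N α) (c : ℝ) : A.expect D (fun _ => c) = c := by
  induction A with
  | output a => rfl
  | unif m next ih =>
    simp only [expect, ih, Finset.sum_const, Finset.card_univ, Fintype.card_fin, nsmul_eq_mul]
    push_cast
    field_simp
  | cond S next ih => simp only [expect, ih, ← Finset.sum_mul, sum_toReal_pmf, one_mul]

theorem expect_sub (A : CondAlg N α) (f g : α → ℝ) :
    A.expect D (fun x => f x - g x) = A.expect D f - A.expect D g := by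
  have := expect_add D A f (fun x => (-1) * g x)
  rw [expect_mul_left] at this
  simpa [sub_eq_add_neg] using this

theorem expect_mono (A : CondAlg N α) {f g : α → ℝ} (h : ∀ x, f x ≤ g x) :
    A.expect D f ≤ A.expect D g := by
  induction A with
  | output a => exact h a
  | unif m next ih =>
    simp only [expect]
    gcongr
    exact ih _
  | cond S next ih =>
    simp only [expect]
    gcongr
    exact ih _

theorem expect_nonneg (A : CondAlg N α) {f : α → ℝ} (h : ∀ x, 0 ≤ f x) : 0 ≤ A.expect D f := by
  simpa [expect_const] using expect_mono D A (f := fun _ => 0) h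

/-- Jensen's inequality for the square. -/
theorem sq_expect_le (A : CondAlg N α) (f : α → ℝ) :
    A.expect D f ^ 2 ≤ A.expect D fun x => f x ^ 2 := by
  have h := expect_nonneg D A (f := fun x => (f x - A.expect D f) ^ 2) fun x => sq_nonneg _
  have e : (fun x => (f x - A.expect D f) ^ 2) =
      fun x => (f x ^ 2 - (2 * A.expect D f) * f x) + A.expect D f ^ 2 := by
    ext x; ring
  rw [e, expect_add, expect_sub, expect_mul_left, expect_const] at h
  nlinarith

theorem toMeasure_run [MeasurableSpace α] (A : CondAlg N α) {s : Set α} (hs : MeasurableSet s) :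
    (A.run D).toMeasure s = ENNReal.ofReal (A.expect D (s.indicator fun _ => 1)) := by
  have nn : ∀ B : CondAlg N α, 0 ≤ B.expect D (s.indicator fun _ => (1 : ℝ)) := fun B =>
    expect_nonneg D B fun x => Set.indicator_nonneg (fun _ _ => zero_le_one) x
  induction A with
  | output a =>
    rw [run, PMF.toMeasure_pure_apply _ _ hs, expect]
    by_cases h : a ∈ s <;> simp [h]
  | unif m next ih =>
    rw [run, PMF.toMeasure_bind_apply _ _ _ hs, tsum_fintype, expect, Finset.sum_div,
      ENNReal.ofReal_sum_of_nonneg fun i _ => div_nonneg (nn _) (by positivity)]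
    refine Finset.sum_congr rfl fun i _ => ?_
    rw [ih, PMF.uniformOfFintype_apply, div_eq_inv_mul, ENNReal.ofReal_mul (by positivity),
      ENNReal.ofReal_inv_of_pos (by positivity)]
    congr 2
    rw [Fintype.card_fin, ← Nat.cast_succ, ENNReal.ofReal_natCast]
  | cond S next ih =>
    rw [run, PMF.toMeasure_bind_apply _ _ _ hs, tsum_fintype, expect,
      ENNReal.ofReal_sum_of_nonneg fun i _ => mul_nonneg ENNReal.toReal_nonneg (nn _)]
    refine Finset.sum_congr rfl fun i _ => ?_
    rw [ih, ENNReal.ofReal_mul ENNReal.toReal_nonneg, ENNReal.ofReal_toReal (PMF.apply_ne_top _ _)]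

end Expect

theorem condOracle_toReal {D : PMF (Fin N)} {S : Finset (Fin N)} (h : ∃ i ∈ S, D i ≠ 0)
    (i : Fin N) : (condOracle D S i).toReal =
      if i ∈ S then (D i).toReal / ∑ j ∈ S, (D j).toReal else 0 := by
  have h' : ∃ i ∈ (S : Set (Fin N)), i ∈ D.support := by
    simpa [PMF.mem_support_iff] using h
  rw [condOracle, dif_pos h', PMF.filter_apply, tsum_fintype]
  by_cases hi : i ∈ S
  · have : ∑ j, (S : Set (Fin N)).indicator D j = ∑ j ∈ S, D j := by
      rw [Finset.sum_indicator_eq_sum_filter]; simp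
    rw [this, Set.indicator_of_mem (by simpa using hi), if_pos hi, ENNReal.toReal_mul,
      ENNReal.toReal_inv, ENNReal.toReal_sum fun i _ => D.apply_ne_top i, div_eq_mul_inv]
  · rw [Set.indicator_of_notMem (by simpa using hi), if_neg hi]; simp

/-- Oracle answers of probability zero enter the expectation with weight zero, so a pointwise bound
is needed only on reachable outputs. -/
theorem Ensures.expect_mono {D : PMF (Fin N)} {A : CondAlg N α} {P : α → Prop}
    (h : A.Ensures D P) {f g : α → ℝ} (hfg : ∀ x, P x → f x ≤ g x) :
    A.expect D f ≤ A.expect D g := by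
  induction A with
  | output a => exact hfg a h
  | unif m next ih =>
    simp only [expect]
    gcongr
    exact ih _ (h _)
  | cond S next ih =>
    simp only [expect]
    refine Finset.sum_le_sum fun i _ => ?_
    rw [condOracle_toReal h.1]
    split_ifs with hi
    · by_cases hD : D i = 0
      · simp [hD]
      · exact mul_le_mul_of_nonneg_left (ih i (h.2 i hi hD)) (by positivity)
    · simp

open Classical in
/-- The probability that the output does not satisfy `P`. -/
def fail (D : PMF (Fin N)) (A : CondAlg N α) (P : α → Prop) : ℝ :=
  A.expect D fun x => if P x then 0 else 1

theorem fail_le_of_le {D : PMF (Fin N)} {A : CondAlg N α} {P : α → Prop} {f : α → ℝ}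
    (h0 : ∀ x, 0 ≤ f x) (h1 : ∀ x, ¬ P x → 1 ≤ f x) : A.fail D P ≤ A.expect D f := by
  refine expect_mono D A fun x => ?_
  split_ifs with h
  · exact h0 x
  · exact h1 x h

/-- Union bound along a composition. `S` holds surely (typically `D z ≠ 0`), `P` only with high
probability; where `P` fails, the second stage is charged the trivial bound 1. -/
theorem fail_bind_le {D : PMF (Fin N)} {A : CondAlg N α} {g : α → CondAlg N β} {S P : α → Prop}
    {R : β → Prop} {δ η : ℝ} (hS : A.Ensures D S) (hA : A.fail D P ≤ δ) (hη : 0 ≤ η)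
    (hg : ∀ x, S x → P x → (g x).fail D R ≤ η) : (A.bind g).fail D R ≤ δ + η := by
  classical
  rw [fail, expect_bind]
  have key : A.expect D (fun x => (g x).expect D fun y => if R y then 0 else 1) ≤
      A.expect D (fun x => (if P x then 0 else 1) + η) := by
    refine hS.expect_mono fun x hx => ?_
    split_ifs with h
    · simpa [fail] using hg x hx h
    · have := CondAlg.expect_mono D (g x) (f := fun y => if R y then (0 : ℝ) else 1)
        (g := fun _ => 1) fun y => by split_ifs <;> norm_num
      rw [expect_const] at this
      linarith
  rw [expect_add, expect_const] at key
  refine key.trans ?_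
  unfold fail at hA
  convert add_le_add_left hA η

theorem toMeasure_run_ge {D : PMF (Fin N)} [MeasurableSpace α] {A : CondAlg N α} {P : α → Prop}
    (hP : MeasurableSet {x | P x}) {δ : ℝ} (h : A.fail D P ≤ δ) :
    ENNReal.ofReal (1 - δ) ≤ (A.run D).toMeasure {x | P x} := by
  classical
  rw [toMeasure_run D A hP]
  refine ENNReal.ofReal_le_ofReal ?_
  have e : A.expect D ({x | P x}.indicator fun _ => 1) = 1 - A.fail D P := by
    have := expect_sub D A (fun _ => 1) (fun x => if P x then 0 else 1)
    rw [expect_const] at this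
    rw [fail, ← this]
    congr 1
    ext x
    by_cases hx : P x <;> simp [hx]
  rw [e]; linarith

end CondAlg

/-! ### Independent repetition: variance, Chebyshev and exponential tails. -/

namespace CondAlg

variable {N : ℕ} {α β : Type}

/-- The output has mean `m` and variance at most `v`. -/
def MeanVar (D : PMF (Fin N)) (A : CondAlg N ℝ) (m v : ℝ) : Prop :=
  A.expect D (fun x => x) = m ∧ A.expect D (fun x => (x - m) ^ 2) ≤ v

/-- The sum of the outputs of `n` independent runs. -/
def sumRuns : ℕ → CondAlg N ℝ → CondAlg N ℝ
  | 0, _ => output 0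
  | n + 1, A => (sumRuns n A).bind fun s => A.bind fun x => output (s + x)

/-- The sum of the outputs of two independent algorithms. -/
def addRuns (A B : CondAlg N ℝ) : CondAlg N ℝ := A.bind fun s => B.bind fun x => output (s + x)

/-- The average of the outputs of `n` independent runs. -/
def avgRuns (n : ℕ) (A : CondAlg N ℝ) : CondAlg N ℝ := (sumRuns n A).bind fun s => output (s / n)

theorem queries_addRuns_le {A B : CondAlg N ℝ} {p q : ℕ} (hA : A.queries ≤ p)
    (hB : B.queries ≤ q) : (addRuns A B).queries ≤ p + q :=
  queries_bind_le hA fun _ => queries_bind_le (q := 0) hB fun _ => le_rfl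

theorem queries_sumRuns_le {A : CondAlg N ℝ} {q : ℕ} (hA : A.queries ≤ q) (n : ℕ) :
    (sumRuns n A).queries ≤ n * q := by
  induction n with
  | zero => simp [sumRuns, queries]
  | succ n ih =>
    rw [add_mul, one_mul]
    exact queries_addRuns_le ih hA

theorem queries_avgRuns_le {A : CondAlg N ℝ} {q : ℕ} (hA : A.queries ≤ q) (n : ℕ) :
    (avgRuns n A).queries ≤ n * q :=
  queries_bind_le (q := 0) (queries_sumRuns_le hA n) fun _ => le_rfl

theorem isPairCond_addRuns {A B : CondAlg N ℝ} (hA : A.IsPairCond) (hB : B.IsPairCond) :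
    (addRuns A B).IsPairCond :=
  isPairCond_bind hA fun _ => isPairCond_bind hB fun _ => trivial

theorem isPairCond_sumRuns {A : CondAlg N ℝ} (hA : A.IsPairCond) (n : ℕ) :
    (sumRuns n A).IsPairCond := by
  induction n with
  | zero => trivial
  | succ n ih => exact isPairCond_addRuns ih hA

theorem isPairCond_avgRuns {A : CondAlg N ℝ} (hA : A.IsPairCond) (n : ℕ) :
    (avgRuns n A).IsPairCond :=
  isPairCond_bind (isPairCond_sumRuns hA n) fun _ => trivial

section Law

variable {D : PMF (Fin N)}

theorem Ensures.addRuns {A B : CondAlg N ℝ} (hA : A.Ensures D fun _ => True)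
    (hB : B.Ensures D fun _ => True) : (addRuns A B).Ensures D fun _ => True :=
  hA.bind fun _ _ => hB.bind fun _ _ => trivial

theorem Ensures.sumRuns {A : CondAlg N ℝ} (hA : A.Ensures D fun _ => True) (n : ℕ) :
    (sumRuns n A).Ensures D fun _ => True := by
  induction n with
  | zero => trivial
  | succ n ih => exact ih.addRuns hA

theorem Ensures.avgRuns {A : CondAlg N ℝ} (hA : A.Ensures D fun _ => True) (n : ℕ) :
    (avgRuns n A).Ensures D fun _ => True :=
  (hA.sumRuns n).bind fun _ _ => trivial

theorem expect_addRuns (A B : CondAlg N ℝ) (f : ℝ → ℝ) :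
    (CondAlg.addRuns A B).expect D f =
      A.expect D fun s => B.expect D fun x => f (s + x) := by
  simp only [CondAlg.addRuns, expect_bind, expect_output]

theorem expect_sumRuns_add (A : CondAlg N ℝ) (m n : ℕ) (f : ℝ → ℝ) :
    (CondAlg.sumRuns (m + n) A).expect D f =
      (CondAlg.sumRuns m A).expect D fun s => (CondAlg.sumRuns n A).expect D fun x =>
        f (s + x) := by
  induction n generalizing f with
  | zero => simp [CondAlg.sumRuns, expect_output]
  | succ n ih =>
    rw [← add_assoc]
    change (CondAlg.addRuns _ _).expect D f = _
    rw [expect_addRuns, ih]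
    congr 1; ext s
    change _ = (CondAlg.addRuns _ _).expect D _
    rw [expect_addRuns]
    simp only [add_assoc]

theorem MeanVar.mono {A : CondAlg N ℝ} {m v w : ℝ} (h : MeanVar D A m v) (hvw : v ≤ w) :
    MeanVar D A m w := ⟨h.1, h.2.trans hvw⟩

/-- The runs are independent, so the cross term has mean zero and the variances add. -/
theorem MeanVar.addRuns {A B : CondAlg N ℝ} {m v m' v' : ℝ} (hA : MeanVar D A m v)
    (hB : MeanVar D B m' v') : MeanVar D (addRuns A B) (m + m') (v + v') := by
  constructor
  · have e : ∀ s, B.expect D (fun x => s + x) = s + m' := fun s => by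
      rw [expect_add D B (fun _ => s) fun x => x, expect_const, hB.1]
    rw [expect_addRuns]
    simp only [e]
    rw [expect_add D A (fun x => x) fun _ => m', expect_const, hA.1]
  · have e : ∀ s : ℝ, (fun x : ℝ => (s + x - (m + m')) ^ 2) =
        fun x => ((s - m) ^ 2 + (2 * (s - m)) * (x - m')) + (x - m') ^ 2 := by
      intro s; ext x; ring
    have z : B.expect D (fun x => x - m') = 0 := by
      rw [expect_sub, expect_const, hB.1, sub_self]
    simp only [expect_addRuns, e, expect_add, expect_const, expect_mul_left, z, mul_zero, add_zero]
    exact add_le_add hA.2 hB.2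

theorem MeanVar.sumRuns {A : CondAlg N ℝ} {m v : ℝ} (hA : MeanVar D A m v) (n : ℕ) :
    MeanVar D (sumRuns n A) (n * m) (n * v) := by
  induction n with
  | zero => simp [MeanVar, CondAlg.sumRuns, expect_output]
  | succ n ih =>
    have := ih.addRuns hA
    push_cast
    rwa [add_mul, add_mul, one_mul, one_mul]

theorem MeanVar.avgRuns {A : CondAlg N ℝ} {m v : ℝ} (hA : MeanVar D A m v) {n : ℕ} (hn : 0 < n) :
    MeanVar D (avgRuns n A) m (v / n) := by
  have hn' : (0 : ℝ) < n := by exact_mod_cast hn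
  obtain ⟨h1, h2⟩ := hA.sumRuns n
  constructor
  · simp only [CondAlg.avgRuns, expect_bind, expect_output, div_eq_mul_inv, expect_mul_right, h1]
    field_simp
  · have e : (fun s : ℝ => (s / n - m) ^ 2) = fun s => (s - n * m) ^ 2 * ((n : ℝ) ^ 2)⁻¹ := by
      ext s; field_simp
    simp only [CondAlg.avgRuns, expect_bind, expect_output, e, expect_mul_right]
    calc _ ≤ (n * v) * ((n : ℝ) ^ 2)⁻¹ := by gcongr
      _ = v / n := by field_simp

theorem meanVar_of_sq_le {A : CondAlg N ℝ} {v : ℝ} (h : A.expect D (fun x => x ^ 2) ≤ v) :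
    MeanVar D A (A.expect D fun x => x) v := by
  refine ⟨rfl, ?_⟩
  set m := A.expect D fun x => x with hm
  have e : (fun x : ℝ => (x - m) ^ 2) = fun x => (x ^ 2 - (2 * m) * x) + m ^ 2 := by
    ext x; ring
  rw [e, expect_add, expect_sub, expect_mul_left, expect_const, ← hm]
  nlinarith [sq_nonneg m]

/-- Chebyshev's inequality. -/
theorem fail_le_of_sq {A : CondAlg N ℝ} {m v δ : ℝ} (h : A.expect D (fun x => (x - m) ^ 2) ≤ v)
    (hδ : 0 < δ) : A.fail D (fun x => |x - m| ≤ δ) ≤ v / δ ^ 2 := by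
  refine (fail_le_of_le (f := fun x => (x - m) ^ 2 * (δ ^ 2)⁻¹) (fun x => by positivity)
    fun x hx => ?_).trans ?_
  · rw [← div_eq_mul_inv, one_le_div (by positivity), ← sq_abs (x - m)]
    push Not at hx
    gcongr
  · rw [expect_mul_right, div_eq_mul_inv]
    gcongr

/-- The output is `1` with probability `p` and `0` otherwise. -/
def IsBernoulli (D : PMF (Fin N)) (A : CondAlg N ℝ) (p : ℝ) : Prop :=
  0 ≤ p ∧ p ≤ 1 ∧ ∀ f, A.expect D f = p * f 1 + (1 - p) * f 0

theorem IsBernoulli.meanVar {A : CondAlg N ℝ} {p : ℝ} (h : IsBernoulli D A p) :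
    MeanVar D A p p := by
  refine ⟨by simp [h.2.2], ?_⟩
  rw [h.2.2]
  nlinarith [h.1, h.2.1, mul_nonneg h.1 h.1]

/-- A mixture of coins is a coin with the averaged bias; this makes comparison with a random partner
a coin. -/
theorem IsBernoulli.bind {A : CondAlg N α} {c : α → CondAlg N ℝ} {p : α → ℝ} {S : α → Prop}
    (hS : A.Ensures D S) (h : ∀ x, S x → IsBernoulli D (c x) (p x)) :
    IsBernoulli D (A.bind c) (A.expect D p) := by
  have e : ∀ f, (A.bind c).expect D f =
      A.expect D fun x => p x * f 1 + (1 - p x) * f 0 := by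
    intro f
    rw [expect_bind]
    exact le_antisymm (hS.expect_mono fun x hx => ((h x hx).2.2 f).le)
      (hS.expect_mono fun x hx => ((h x hx).2.2 f).ge)
  refine ⟨?_, ?_, fun f => ?_⟩
  · simpa [expect_const] using hS.expect_mono (f := fun _ => 0) fun x hx => (h x hx).1
  · simpa [expect_const] using hS.expect_mono (g := fun _ => 1) fun x hx => (h x hx).2.1
  · rw [e, expect_add, expect_mul_right, expect_mul_right, expect_sub, expect_const]

/-- Each flip contributes a factor 1 + p(e - 1) ≤ 1 + 2p ≤ exp(2p). -/
theorem IsBernoulli.expect_exp_sumRuns_le {A : CondAlg N ℝ} {p : ℝ} (h : IsBernoulli D A p)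
    (n : ℕ) : (CondAlg.sumRuns n A).expect D Real.exp ≤ Real.exp (2 * p * n) := by
  induction n with
  | zero => simp [CondAlg.sumRuns, expect_output]
  | succ n ih =>
    change (CondAlg.addRuns _ _).expect D _ ≤ _
    rw [expect_addRuns]
    simp only [Real.exp_add, expect_mul_left, expect_mul_right]
    push_cast
    rw [mul_add, mul_one, Real.exp_add]
    refine mul_le_mul ih ?_ (expect_nonneg D A fun x => (Real.exp_pos x).le) (Real.exp_pos _).le
    rw [h.2.2, Real.exp_zero]
    have := Real.add_one_le_exp (2 * p)
    nlinarith [h.1, Real.exp_one_lt_d9]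

/-- An exponential upper tail bound for a sum of independent Bernoulli variables. -/
theorem IsBernoulli.fail_sumRuns_lt {A : CondAlg N ℝ} {p σ : ℝ} (h : IsBernoulli D A p)
    {n : ℕ} (hσ : n * p ≤ σ / 4) :
    (CondAlg.sumRuns n A).fail D (fun x => x < σ) ≤ Real.exp (-(σ / 2)) := by
  refine (fail_le_of_le (f := fun x => Real.exp (-σ) * Real.exp x) (fun x => by positivity)
    fun x hx => ?_).trans ?_
  · rw [← Real.exp_add]
    push Not at hx
    exact Real.one_le_exp (by linarith)
  · rw [expect_mul_left]
    refine (mul_le_mul_of_nonneg_left (h.expect_exp_sumRuns_le n) (Real.exp_pos _).le).trans ?_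
    rw [← Real.exp_add]
    exact Real.exp_le_exp.2 (by linarith)

/-- Relative concentration of a sum of independent Bernoulli variables. -/
theorem IsBernoulli.fail_sumRuns_abs_le {A : CondAlg N ℝ} {p δ : ℝ} (h : IsBernoulli D A p)
    (hp : 0 < p) (hδ : 0 < δ) {n : ℕ} (hn : 0 < n) :
    (CondAlg.sumRuns n A).fail D (fun x => |x - n * p| ≤ δ * (n * p)) ≤ 1 / (δ ^ 2 * (n * p)) := by
  have hn' : (0 : ℝ) < n := by exact_mod_cast hn
  refine (fail_le_of_sq (h.meanVar.sumRuns n).2 (by positivity)).trans (le_of_eq ?_)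
  field_simp

end Law

end CondAlg

/-! ### The truncated odds ratio and its stability. -/

/-- For `0 ≤ p ≤ 1` this is `min (s / ρ) 1`, where `s = p / (1 - p)`. -/
def cutRatio (ρ p : ℝ) : ℝ := max p 0 / max p (ρ * (1 - p))

section CutRatio

variable {ρ : ℝ}

theorem cutRatio_denom_pos (hρ : 0 < ρ) (p : ℝ) : 0 < max p (ρ * (1 - p)) := by
  rcases lt_or_ge 0 p with h | h
  · exact lt_max_of_lt_left h
  · exact lt_max_of_lt_right (mul_pos hρ (by linarith))

theorem cutRatio_nonneg (hρ : 0 < ρ) (p : ℝ) : 0 ≤ cutRatio ρ p :=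
  div_nonneg (le_max_right _ _) (cutRatio_denom_pos hρ p).le

theorem cutRatio_le_one (hρ : 0 < ρ) (p : ℝ) : cutRatio ρ p ≤ 1 :=
  div_le_one_of_le₀ (max_le (le_max_left _ _) (cutRatio_denom_pos hρ p).le)
    (cutRatio_denom_pos hρ p).le

theorem abs_cutRatio_sub_le (hρ : 0 < ρ) (hρ1 : ρ ≤ 1) {p : ℝ} (hp : 0 ≤ p) (q : ℝ) :
    |cutRatio ρ q - cutRatio ρ p| ≤ 4 * |q - p| / max p ρ := by
  set g : ℝ → ℝ := fun x => max x (ρ * (1 - x)) with hg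
  have gp : 0 < g p := cutRatio_denom_pos hρ p
  have gq : 0 < g q := cutRatio_denom_pos hρ q
  have hM : 0 < max p ρ := lt_max_of_lt_right hρ
  -- The quotients are compared over the denominator at `p` alone, so the arbitrary empirical value
  -- `q` needs no lower bound on its own denominator.
  have e : cutRatio ρ q - cutRatio ρ p =
      ((max q 0 - max p 0) + cutRatio ρ q * (g p - g q)) / g p := by
    have : max q 0 = cutRatio ρ q * g q := by
      simp only [cutRatio, hg]; rw [div_mul_cancel₀ _ gq.ne']
    have h2 : max p 0 = cutRatio ρ p * g p := by
      simp only [cutRatio, hg]; rw [div_mul_cancel₀ _ gp.ne']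
    rw [eq_div_iff gp.ne', h2, this]; ring
  have lf : |max q 0 - max p 0| ≤ |q - p| := by
    simpa using abs_max_sub_max_le_max q 0 p 0
  have lg : |g p - g q| ≤ |q - p| := by
    refine (abs_max_sub_max_le_max _ _ _ _).trans (max_le (abs_sub_comm p q).le ?_)
    rw [show ρ * (1 - p) - ρ * (1 - q) = ρ * (q - p) by ring, abs_mul, abs_of_pos hρ]
    exact mul_le_of_le_one_left (abs_nonneg _) hρ1
  have num : |(max q 0 - max p 0) + cutRatio ρ q * (g p - g q)| ≤ 2 * |q - p| := by
    refine (abs_add_le _ _).trans ?_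
    rw [abs_mul, abs_of_nonneg (cutRatio_nonneg hρ q)]
    have := mul_le_mul (cutRatio_le_one hρ q) lg (abs_nonneg _) zero_le_one
    linarith
  have hgM : max p ρ ≤ 2 * g p := by
    have h1 : p ≤ g p := le_max_left _ _
    have h2 : ρ * (1 - p) ≤ g p := le_max_right _ _
    exact max_le (by linarith) (by nlinarith [mul_nonneg hp (sub_nonneg.2 hρ1)])
  rw [e, abs_div, abs_of_pos gp, div_le_div_iff₀ gp hM]
  have := mul_le_mul num hgM hM.le (by positivity)
  linarith

/-- The left side is the variance bound `p` of one flip times the squared local Lipschitz constant,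
up to a factor. Bounding it linearly in `cutRatio` is what makes all later errors proportional to Φ.
-/
theorem div_sq_max_le_cutRatio (hρ : 0 < ρ) {p : ℝ} (hp : 0 ≤ p) :
    p / max p ρ ^ 2 ≤ cutRatio ρ p / ρ := by
  have hM : 0 < max p ρ := lt_max_of_lt_right hρ
  have h1 : p / max p ρ ≤ cutRatio ρ p := by
    rw [cutRatio, max_eq_left hp]
    refine div_le_div_of_nonneg_left hp (cutRatio_denom_pos hρ p) (max_le_max le_rfl ?_)
    nlinarith
  rw [sq, ← div_div]
  exact div_le_div₀ (cutRatio_nonneg hρ p) h1 hρ (le_max_right _ _)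

end CutRatio

/-! ### Multilevel Monte Carlo estimation of the mean truncated ratio. -/

namespace CondAlg

variable {N : ℕ} {α : Type}

/-- Draw `x`, estimate the bias of the coin of `x` by `n` flips, and apply `cutRatio`. -/
def plainEstimate (smp : CondAlg N α) (c : α → CondAlg N ℝ) (ρ : ℝ) (n : ℕ) : CondAlg N ℝ :=
  smp.bind fun x => (sumRuns n (c x)).bind fun s => output (cutRatio ρ (s / n))

/-- Draw `x` and compare the estimates of `cutRatio` from `2 n` flips and from the first `n` of
them. -/
def levelEstimate (smp : CondAlg N α) (c : α → CondAlg N ℝ) (ρ : ℝ) (n : ℕ) : CondAlg N ℝ :=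
  smp.bind fun x => (sumRuns n (c x)).bind fun s => (sumRuns n (c x)).bind fun s' =>
    output (cutRatio ρ ((s + s') / ((n + n : ℕ) : ℝ)) - cutRatio ρ (s / n))

/-- The first `j` levels of the multilevel Monte Carlo estimator. -/
def multilevelAux (smp : CondAlg N α) (c : α → CondAlg N ℝ) (ρ : ℝ) (n R K : ℕ) :
    ℕ → CondAlg N ℝ
  | 0 => avgRuns (R * 2 ^ K) (plainEstimate smp c ρ n)
  | j + 1 => addRuns (multilevelAux smp c ρ n R K j)
      (avgRuns (R * 2 ^ (K - j)) (levelEstimate smp c ρ (n * 2 ^ j)))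

/-- The multilevel Monte Carlo estimator with `K` levels of the mean of `cutRatio ρ`. -/
def multilevel (smp : CondAlg N α) (c : α → CondAlg N ℝ) (ρ : ℝ) (K : ℕ) : CondAlg N ℝ :=
  multilevelAux smp c ρ ⌈1 / ρ⌉₊ (K + 1) K K

section Syntactic

variable {smp : CondAlg N α} {c : α → CondAlg N ℝ} {ρ : ℝ}

theorem isPairCond_multilevel (hs : smp.IsPairCond) (hc : ∀ x, (c x).IsPairCond) (K : ℕ) :
    (multilevel smp c ρ K).IsPairCond := by
  have key : ∀ n R j, (multilevelAux smp c ρ n R K j).IsPairCond := by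
    intro n R j
    induction j with
    | zero =>
      exact isPairCond_avgRuns (isPairCond_bind hs fun x =>
        isPairCond_bind (isPairCond_sumRuns (hc x) _) fun _ => by trivial) _
    | succ j ih =>
      exact isPairCond_addRuns ih (isPairCond_avgRuns (isPairCond_bind hs fun x =>
        isPairCond_bind (isPairCond_sumRuns (hc x) _) fun _ =>
          isPairCond_bind (isPairCond_sumRuns (hc x) _) fun _ => by trivial) _)
  exact key _ _ _

theorem Ensures.multilevel {D : PMF (Fin N)} (hs : smp.Ensures D fun _ => True)
    (hc : ∀ x, (c x).Ensures D fun _ => True) (K : ℕ) :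
    (multilevel smp c ρ K).Ensures D fun _ => True := by
  have key : ∀ n R j, (multilevelAux smp c ρ n R K j).Ensures D fun _ => True := by
    intro n R j
    induction j with
    | zero =>
      exact Ensures.avgRuns (hs.bind fun x _ => ((hc x).sumRuns _).bind fun _ _ => by trivial) _
    | succ j ih =>
      exact ih.addRuns (Ensures.avgRuns (hs.bind fun x _ =>
        ((hc x).sumRuns _).bind fun _ _ => ((hc x).sumRuns _).bind fun _ _ => by trivial) _)
  exact key _ _ _

theorem queries_multilevel_le (hs : smp.queries ≤ 1) (hc : ∀ x, (c x).queries ≤ 1)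
    (hρ : 0 < ρ) (K : ℕ) :
    (multilevel smp c ρ K).queries ≤ 3 * (K + 1) ^ 2 * (⌈1 / ρ⌉₊ * 2 ^ K) := by
  have hn : 1 ≤ ⌈1 / ρ⌉₊ := Nat.one_le_iff_ne_zero.2 (Nat.ceil_pos.2 (by positivity)).ne'
  set n := ⌈1 / ρ⌉₊ with hn_def
  have key : ∀ R j, j ≤ K →
      (multilevelAux smp c ρ n R K j).queries ≤ (j + 1) * (R * 2 ^ K * (3 * n)) := by
    intro R j
    induction j with
    | zero =>
      intro _
      rw [zero_add, one_mul]
      refine queries_avgRuns_le ?_ _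
      refine (queries_bind_le hs fun x => queries_bind_le (q := 0)
        (queries_sumRuns_le (hc x) _) fun _ => le_rfl).trans ?_
      omega
    | succ j ih =>
      intro hj
      rw [add_mul _ 1, one_mul]
      refine queries_addRuns_le (ih (by omega)) ?_
      have hl : (levelEstimate smp c ρ (n * 2 ^ j)).queries ≤ 2 ^ j * (3 * n) := by
        refine (queries_bind_le hs fun x => queries_bind_le (queries_sumRuns_le (hc x) _)
          fun _ => queries_bind_le (q := 0) (queries_sumRuns_le (hc x) _) fun _ => le_rfl).trans ?_
        have : 1 ≤ n * 2 ^ j := Nat.one_le_iff_ne_zero.2 (by positivity)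
        linarith
      refine (queries_avgRuns_le hl _).trans (le_of_eq ?_)
      -- The number of runs halves as the cost of a run doubles, so all levels obey the same cost
      -- bound.
      rw [← Nat.sub_add_cancel (show j ≤ K by omega), pow_add, Nat.add_sub_cancel]
      ring
  refine (key (K + 1) K le_rfl).trans (le_of_eq ?_)
  ring

end Syntactic

section Law

variable {D : PMF (Fin N)} {smp : CondAlg N α} {c : α → CondAlg N ℝ} {ρ : ℝ} {p : α → ℝ}

theorem IsBernoulli.expect_sq_cutRatio_le {A : CondAlg N ℝ} {p : ℝ} (h : IsBernoulli D A p)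
    (hρ : 0 < ρ) (hρ1 : ρ ≤ 1) {n : ℕ} (hn : 0 < n) :
    (CondAlg.sumRuns n A).expect D (fun s => (cutRatio ρ (s / n) - cutRatio ρ p) ^ 2) ≤
      16 * cutRatio ρ p / (ρ * n) := by
  have hn' : (0 : ℝ) < n := by exact_mod_cast hn
  have hM : 0 < max p ρ := lt_max_of_lt_right hρ
  have pt : ∀ s : ℝ, (cutRatio ρ (s / n) - cutRatio ρ p) ^ 2 ≤
      16 / (n ^ 2 * max p ρ ^ 2) * (s - n * p) ^ 2 := by
    intro s
    have := abs_cutRatio_sub_le hρ hρ1 h.1 (s / n)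
    rw [← sq_abs]
    calc _ ≤ (4 * |s / n - p| / max p ρ) ^ 2 := by gcongr
      _ = 16 * (s / n - p) ^ 2 / max p ρ ^ 2 := by rw [div_pow, mul_pow, sq_abs]; norm_num
      _ = _ := by field_simp
  refine (expect_mono D _ pt).trans ?_
  rw [expect_mul_left]
  calc _ ≤ 16 / (n ^ 2 * max p ρ ^ 2) * (n * p) := by
        gcongr
        exact (h.meanVar.sumRuns n).2
    _ = 16 / n * (p / max p ρ ^ 2) := by field_simp
    _ ≤ 16 / n * (cutRatio ρ p / ρ) := by
        exact mul_le_mul_of_nonneg_left (div_sq_max_le_cutRatio hρ h.1) (by positivity)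
    _ = _ := by field_simp

variable (hc : ∀ x, IsBernoulli D (c x) (p x)) (hρ : 0 < ρ) (hρ1 : ρ ≤ 1)
include hc hρ hρ1

theorem expect_plainEstimate_sq_le {n : ℕ} (hn : 1 ≤ ρ * n) :
    (plainEstimate smp c ρ n).expect D (fun y => y ^ 2) ≤
      48 * smp.expect D fun x => cutRatio ρ (p x) := by
  have hn' : (0 : ℝ) < n := by by_contra h; nlinarith
  rw [plainEstimate, expect_bind, ← expect_mul_left]
  refine expect_mono D _ fun x => ?_
  simp only [expect_bind, expect_output]
  have h0 := cutRatio_nonneg hρ (p x)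
  have h1 := cutRatio_le_one hρ (p x)
  have := (hc x).expect_sq_cutRatio_le hρ hρ1 (Nat.cast_pos.1 hn')
  have h2 : 16 * cutRatio ρ (p x) / (ρ * n) ≤ 16 * cutRatio ρ (p x) :=
    div_le_self (by positivity) hn
  -- Splits y² ≤ 2(y - h)² + 2h² at the true value h; since h ≤ 1, also h² ≤ h, which keeps the
  -- bound linear in h.
  calc _ ≤ (sumRuns n (c x)).expect D (fun s =>
          2 * (cutRatio ρ (s / n) - cutRatio ρ (p x)) ^ 2 + 2 * cutRatio ρ (p x) ^ 2) :=
        expect_mono D _ fun s => by nlinarith [sq_nonneg (cutRatio ρ (s / n) - 2 * cutRatio ρ (p x))]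
    _ ≤ _ := by
        rw [expect_add, expect_mul_left, expect_const]
        nlinarith

theorem expect_levelEstimate_sq_le {n : ℕ} (hn : 0 < n) :
    (levelEstimate smp c ρ n).expect D (fun y => y ^ 2) ≤
      48 * (smp.expect D fun x => cutRatio ρ (p x)) / (ρ * n) := by
  have hn' : (0 : ℝ) < n := by exact_mod_cast hn
  rw [levelEstimate, expect_bind, mul_div_right_comm, ← expect_mul_left]
  refine expect_mono D _ fun x => ?_
  simp only [expect_bind, expect_output]
  set h := cutRatio ρ (p x)
  have h1 := (hc x).expect_sq_cutRatio_le hρ hρ1 hn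
  have h2 := (hc x).expect_sq_cutRatio_le hρ hρ1 (Nat.add_pos_left hn n)
  rw [expect_sumRuns_add] at h2
  calc _ ≤ (sumRuns n (c x)).expect D (fun s => (sumRuns n (c x)).expect D fun s' =>
          2 * (cutRatio ρ ((s + s') / ((n + n : ℕ) : ℝ)) - h) ^ 2 +
            2 * (cutRatio ρ (s / n) - h) ^ 2) :=
        expect_mono D _ fun s => expect_mono D _ fun s' => by
          nlinarith [sq_nonneg (cutRatio ρ ((s + s') / ((n + n : ℕ) : ℝ)) +
            cutRatio ρ (s / n) - 2 * h)]
    _ ≤ 2 * (16 * h / (ρ * (n + n : ℕ))) + 2 * (16 * h / (ρ * n)) := by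
        simp only [expect_add, expect_mul_left, expect_const]
        linarith
    _ = _ := by push_cast; field_simp; ring

omit hc hρ hρ1 in
-- The sum of two independent blocks of n flips is distributed as 2n flips. This is the telescoping
-- identity behind the multilevel scheme.
theorem expect_levelEstimate (n : ℕ) : (levelEstimate smp c ρ n).expect D (fun y => y) =
    (plainEstimate smp c ρ (n + n)).expect D (fun y => y) -
      (plainEstimate smp c ρ n).expect D fun y => y := by
  simp only [levelEstimate, plainEstimate, expect_bind, expect_output, expect_sumRuns_add,
    expect_sub, expect_const]

/-- The bias is controlled by the mean square error, using Jensen once over `x` and once over the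
flips. -/
theorem sq_expect_plainEstimate_sub_le {n : ℕ} (hn : 0 < n) :
    ((plainEstimate smp c ρ n).expect D (fun y => y) -
      smp.expect D fun x => cutRatio ρ (p x)) ^ 2 ≤
      16 * (smp.expect D fun x => cutRatio ρ (p x)) / (ρ * n) := by
  rw [plainEstimate, expect_bind, ← expect_sub]
  refine (sq_expect_le D _ _).trans ?_
  rw [mul_div_right_comm, ← expect_mul_left]
  refine expect_mono D _ fun x => ?_
  simp only [expect_bind, expect_output]
  have h1 := (hc x).expect_sq_cutRatio_le hρ hρ1 hn
  have h2 := sq_expect_le D (sumRuns n (c x)) fun s => cutRatio ρ (s / n) - cutRatio ρ (p x)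
  rw [expect_sub, expect_const] at h2
  refine h2.trans (h1.trans (le_of_eq ?_))
  ring

/-- The means telescope, leaving only the bias of the finest level. A run at level j has second
moment at most 48Φ/2^j because ρn ≥ 1; averaged over R·2^(K-j) runs, every level contributes the
same 48Φ/(R·2^K). -/
theorem meanVar_multilevelAux {n R K : ℕ} (hn : 1 ≤ ρ * n) (hR : 0 < R) {j : ℕ} (hj : j ≤ K) :
    MeanVar D (multilevelAux smp c ρ n R K j)
      ((plainEstimate smp c ρ (n * 2 ^ j)).expect D fun y => y)
      ((j + 1) * (48 * (smp.expect D fun x => cutRatio ρ (p x)) / (R * 2 ^ K))) := by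
  have hΦ : 0 ≤ smp.expect D fun x => cutRatio ρ (p x) :=
    expect_nonneg D _ fun x => cutRatio_nonneg hρ _
  set Φ := smp.expect D fun x => cutRatio ρ (p x)
  have hn' : (0 : ℝ) < n := by by_contra h; nlinarith
  have hR' : (0 : ℝ) < R := by exact_mod_cast hR
  induction j with
  | zero =>
    have := (meanVar_of_sq_le (expect_plainEstimate_sq_le (smp := smp) hc hρ hρ1 hn)).avgRuns
      (n := R * 2 ^ K) (by positivity)
    push_cast at this
    simpa [multilevelAux] using this
  | succ j ih =>
    have hpos : 0 < n * 2 ^ j := Nat.mul_pos (Nat.cast_pos.1 hn') (by positivity)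
    have h := (meanVar_of_sq_le (expect_levelEstimate_sq_le (smp := smp) hc hρ hρ1 hpos)).avgRuns
      (n := R * 2 ^ (K - j)) (by positivity)
    have h' := (ih (by omega)).addRuns h
    rw [expect_levelEstimate] at h'
    have e : n * 2 ^ j + n * 2 ^ j = n * 2 ^ (j + 1) := by ring
    rw [e, add_sub_cancel] at h'
    refine h'.mono ?_
    push_cast
    rw [add_mul ((j : ℝ) + 1) 1, one_mul]
    refine add_le_add_right ?_ _
    have hK : (2 : ℝ) ^ K = 2 ^ (K - j) * 2 ^ j := by
      rw [← pow_add, Nat.sub_add_cancel (by omega)]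
    rw [hK, div_div]
    refine div_le_div_of_nonneg_left (by positivity) (by positivity) ?_
    calc (R : ℝ) * (2 ^ (K - j) * 2 ^ j) = 1 * (R * (2 ^ (K - j) * 2 ^ j)) := by ring
      _ ≤ (ρ * n) * (R * (2 ^ (K - j) * 2 ^ j)) := by gcongr
      _ = _ := by ring

theorem expect_multilevel_sq_le (K : ℕ) :
    (multilevel smp c ρ K).expect D
      (fun y => (y - smp.expect D fun x => cutRatio ρ (p x)) ^ 2) ≤
      64 * (smp.expect D fun x => cutRatio ρ (p x)) / 2 ^ K := by
  have hn : 1 ≤ ρ * ⌈1 / ρ⌉₊ := by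
    have := Nat.le_ceil (1 / ρ)
    calc 1 = ρ * (1 / ρ) := by field_simp
      _ ≤ _ := by gcongr
  have h := meanVar_multilevelAux (smp := smp) hc hρ hρ1 hn (Nat.succ_pos K) (le_refl K)
  have hpos : 0 < ⌈1 / ρ⌉₊ * 2 ^ K :=
    Nat.mul_pos (Nat.ceil_pos.2 (by positivity)) (by positivity)
  have hb := sq_expect_plainEstimate_sub_le (smp := smp) hc hρ hρ1 hpos
  have hΦ : 0 ≤ smp.expect D fun x => cutRatio ρ (p x) :=
    expect_nonneg D _ fun x => cutRatio_nonneg hρ _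
  set Φ := smp.expect D fun x => cutRatio ρ (p x)
  set m := (plainEstimate smp c ρ (⌈1 / ρ⌉₊ * 2 ^ K)).expect D fun y => y
  -- Mean square error is variance plus squared bias: 48Φ/2^K, where R = K + 1 cancels the number of
  -- levels, plus 16Φ/2^K.
  have e : (fun y : ℝ => (y - Φ) ^ 2) =
      fun y => ((y - m) ^ 2 + (2 * (m - Φ)) * (y - m)) + (m - Φ) ^ 2 := by
    ext y; ring
  rw [multilevel, e, expect_add, expect_add, expect_mul_left, expect_sub, expect_const,
    expect_const, h.1, sub_self, mul_zero, add_zero]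
  have h1 := h.2
  have e1 : ((K : ℝ) + 1) * (48 * Φ / (((K.succ : ℕ) : ℝ) * 2 ^ K)) = 48 * Φ / 2 ^ K := by
    push_cast; field_simp
  rw [e1] at h1
  have h2 : 16 * Φ / (ρ * ((⌈1 / ρ⌉₊ * 2 ^ K : ℕ) : ℝ)) ≤ 16 * Φ / 2 ^ K := by
    refine div_le_div_of_nonneg_left (by positivity) (by positivity) ?_
    push_cast
    calc (2 : ℝ) ^ K = 1 * 2 ^ K := by ring
      _ ≤ (ρ * ⌈1 / ρ⌉₊) * 2 ^ K := by gcongr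
      _ = _ := by ring
  calc _ ≤ 48 * Φ / 2 ^ K + 16 * Φ / 2 ^ K := add_le_add h1 (hb.trans h2)
    _ = _ := by ring

end Law

end CondAlg

/-! ### Comparisons with a reference element, and its selection. -/

namespace CondAlg

variable {N : ℕ} {α : Type}

section Fail

variable {D : PMF (Fin N)}

theorem fail_eq_zero {A : CondAlg N α} {P : α → Prop} (h : A.Ensures D P) : A.fail D P ≤ 0 := by
  classical
  have := h.expect_mono (f := fun x => if P x then 0 else 1) (g := fun _ => 0) fun x hx => by
    simp [hx]
  rw [expect_const] at this
  unfold fail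
  convert this

theorem fail_mono {A : CondAlg N α} {P R : α → Prop} (h : ∀ x, P x → R x) :
    A.fail D R ≤ A.fail D P :=
  expect_mono D A fun x => by
    by_cases hP : P x
    · simp [hP, h x hP]
    · rw [if_neg hP]; split_ifs <;> norm_num

theorem fail_and_le {A : CondAlg N α} {P R : α → Prop} :
    A.fail D (fun x => P x ∧ R x) ≤ A.fail D P + A.fail D R := by
  unfold fail
  rw [← expect_add]
  refine expect_mono D A fun x => ?_
  by_cases hP : P x <;> by_cases hR : R x <;> simp [hP, hR]

theorem fail_output {a : α} {P : α → Prop} (h : P a) :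
    (output a : CondAlg N α).fail D P ≤ 0 := fail_eq_zero (A := output a) h

end Fail

/-- `Samp()`. -/
def samp : CondAlg N (Fin N) := cond Finset.univ output

/-- A uniformly random element of `[N]`, without any query. -/
def unifElem [NeZero N] : CondAlg N (Fin N) :=
  unif (N - 1) fun i => output (Fin.cast (Nat.sub_add_cancel NeZero.one_le) i)

/-- Returns `1` if the answer to `Pcond(x, y)` is `x` and `0` if it is `y`; a fair coin flip for
`x = y`. -/
def compare (x y : Fin N) : CondAlg N ℝ :=
  if x = y then unif 1 fun i => output (i : ℕ)
  else cond {x, y} fun i => output (if i = x then 1 else 0)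

/-- Compares `z` with a sample from the unknown distribution. -/
def compareSamp (z : Fin N) : CondAlg N ℝ := samp.bind fun x => compare z x

/-- Compares a uniformly random element with `z`. -/
def compareUnif [NeZero N] (z : Fin N) : CondAlg N ℝ := unifElem.bind fun x => compare x z

/-- A sample `z` together with the smaller of the numbers of successes in `Q` runs of
`compareSamp z` and of `compareUnif z`. -/
def candidate [NeZero N] (Q : ℕ) : CondAlg N (Fin N × ℝ) :=
  samp.bind fun z => (sumRuns Q (compareSamp z)).bind fun s =>
    (sumRuns Q (compareUnif z)).bind fun s' => output (z, min s s')

/-- The best of `j + 1` candidates. -/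
def select [NeZero N] (Q : ℕ) : ℕ → CondAlg N (Fin N × ℝ)
  | 0 => candidate Q
  | j + 1 => (select Q j).bind fun w => (candidate Q).bind fun w' =>
      output (if w.2 < w'.2 then w' else w)

section Syntactic

theorem isPairCond_samp : (samp : CondAlg N (Fin N)).IsPairCond := ⟨Or.inl rfl, fun _ => trivial⟩

theorem queries_samp_le : (samp : CondAlg N (Fin N)).queries ≤ 1 := by
  simp [samp, queries]

theorem isPairCond_unifElem [NeZero N] : (unifElem : CondAlg N (Fin N)).IsPairCond :=
  fun _ => trivial

theorem queries_unifElem_le [NeZero N] : (unifElem : CondAlg N (Fin N)).queries ≤ 0 := by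
  simp [unifElem, queries]

theorem isPairCond_compare (x y : Fin N) : (compare x y).IsPairCond := by
  unfold compare
  split_ifs with h
  · exact fun _ => trivial
  · exact ⟨Or.inr ⟨x, y, h, rfl⟩, fun _ => trivial⟩

theorem queries_compare_le (x y : Fin N) : (compare x y).queries ≤ 1 := by
  unfold compare
  split_ifs <;> simp [queries]

theorem isPairCond_compareSamp (z : Fin N) : (compareSamp z).IsPairCond :=
  isPairCond_bind isPairCond_samp fun x => isPairCond_compare z x

theorem queries_compareSamp_le (z : Fin N) : (compareSamp z).queries ≤ 2 :=
  queries_bind_le queries_samp_le fun x => queries_compare_le z x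

variable [NeZero N]

theorem isPairCond_compareUnif (z : Fin N) : (compareUnif z).IsPairCond :=
  isPairCond_bind isPairCond_unifElem fun x => isPairCond_compare x z

theorem queries_compareUnif_le (z : Fin N) : (compareUnif z).queries ≤ 1 :=
  queries_bind_le queries_unifElem_le fun x => queries_compare_le x z

theorem isPairCond_candidate (Q : ℕ) : (candidate Q : CondAlg N _).IsPairCond :=
  isPairCond_bind isPairCond_samp fun z =>
    isPairCond_bind (isPairCond_sumRuns (isPairCond_compareSamp z) _) fun _ =>
      isPairCond_bind (isPairCond_sumRuns (isPairCond_compareUnif z) _) fun _ => trivial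

theorem queries_candidate_le (Q : ℕ) : (candidate Q : CondAlg N _).queries ≤ 1 + 3 * Q := by
  refine (queries_bind_le queries_samp_le fun z =>
    queries_bind_le (queries_sumRuns_le (queries_compareSamp_le z) _) fun _ =>
      queries_bind_le (q := 0) (queries_sumRuns_le (queries_compareUnif_le z) _)
        fun _ => le_rfl).trans ?_
  omega

theorem isPairCond_select (Q j : ℕ) : (select Q j : CondAlg N _).IsPairCond := by
  induction j with
  | zero => exact isPairCond_candidate Q
  | succ j ih =>
    exact isPairCond_bind ih fun _ => isPairCond_bind (isPairCond_candidate Q) fun _ => trivial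

theorem queries_select_le (Q j : ℕ) :
    (select Q j : CondAlg N _).queries ≤ (j + 1) * (1 + 3 * Q) := by
  induction j with
  | zero => simpa [select] using queries_candidate_le (N := N) Q
  | succ j ih =>
    rw [add_mul _ 1, one_mul]
    exact queries_bind_le ih fun _ => queries_bind_le (q := 0) (queries_candidate_le Q)
      fun _ => le_rfl

end Syntactic

section Law

variable {D : PMF (Fin N)}

theorem ensures_samp : (samp : CondAlg N (Fin N)).Ensures D fun x => D x ≠ 0 := by
  obtain ⟨i, hi⟩ := D.support_nonempty
  exact ⟨⟨i, Finset.mem_univ i, (PMF.mem_support_iff D i).1 hi⟩, fun i _ h => h⟩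

theorem expect_samp (f : Fin N → ℝ) : samp.expect D f = ∑ x, (D x).toReal * f x := by
  obtain ⟨i, hi⟩ := D.support_nonempty
  rw [samp, expect]
  refine Finset.sum_congr rfl fun x _ => ?_
  rw [condOracle_toReal ⟨i, Finset.mem_univ i, (PMF.mem_support_iff D i).1 hi⟩, sum_toReal_pmf,
    if_pos (Finset.mem_univ x), div_one, expect]

theorem toReal_pos {x : Fin N} (hx : D x ≠ 0) : 0 < (D x).toReal :=
  ENNReal.toReal_pos hx (D.apply_ne_top x)

theorem ensures_compare {x y : Fin N} (h : D x ≠ 0 ∨ D y ≠ 0) :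
    (compare x y).Ensures D fun _ => True := by
  unfold compare
  split_ifs with hxy
  · exact fun _ => trivial
  · refine ⟨?_, fun _ _ _ => trivial⟩
    rcases h with h | h
    · exact ⟨x, by simp, h⟩
    · exact ⟨y, by simp, h⟩

/-- For `x = y` the formula gives 1/2, which is why `compare` then flips a fair coin. -/
theorem isBernoulli_compare {x y : Fin N} (h : D x ≠ 0 ∨ D y ≠ 0) :
    IsBernoulli D (compare x y) ((D x).toReal / ((D x).toReal + (D y).toReal)) := by
  have hx : 0 ≤ (D x).toReal := ENNReal.toReal_nonneg
  have hy : 0 ≤ (D y).toReal := ENNReal.toReal_nonneg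
  have hpos : 0 < (D x).toReal + (D y).toReal := by
    rcases h with h | h
    · linarith [toReal_pos h]
    · linarith [toReal_pos h]
  refine ⟨by positivity, div_le_one_of_le₀ (by linarith) hpos.le, fun f => ?_⟩
  unfold compare
  split_ifs with hxy
  · subst hxy
    have : (D x).toReal ≠ 0 := by intro h0; simp [h0] at hpos
    have e : ∑ i : Fin (1 + 1), f ((i : ℕ) : ℝ) = f 0 + f 1 :=
      (Fin.sum_univ_two fun i : Fin 2 => f ((i : ℕ) : ℝ)).trans (by simp)
    simp only [expect, e]
    field_simp
    norm_num
    ring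
  · have hex : ∃ i ∈ ({x, y} : Finset (Fin N)), D i ≠ 0 := by
      rcases h with h | h
      · exact ⟨x, by simp, h⟩
      · exact ⟨y, by simp, h⟩
    simp only [expect, condOracle_toReal hex, ite_mul, zero_mul, Finset.sum_ite_mem,
      Finset.univ_inter, Finset.sum_pair hxy, if_neg (Ne.symm hxy), if_true]
    field_simp
    ring

theorem Ensures.true {A : CondAlg N α} {P : α → Prop} (h : A.Ensures D P) :
    A.Ensures D fun _ => True := by
  induction A with
  | output a => trivial
  | unif m next ih => exact fun i => ih i (h i)
  | cond S next ih => exact ⟨h.1, fun i hi hD => ih i (h.2 i hi hD)⟩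

/-- The success probability of `compareSamp z`. -/
def probSamp (D : PMF (Fin N)) (z : Fin N) : ℝ :=
  ∑ x, (D x).toReal * ((D z).toReal / ((D z).toReal + (D x).toReal))

/-- The success probability of `compareUnif z`. -/
def probUnif (D : PMF (Fin N)) (z : Fin N) : ℝ :=
  (∑ x, (D x).toReal / ((D x).toReal + (D z).toReal)) / N

theorem isBernoulli_compareSamp {z : Fin N} (hz : D z ≠ 0) :
    IsBernoulli D (compareSamp z) (probSamp D z) := by
  have := IsBernoulli.bind (c := fun x => compare z x) (ensures_samp (D := D)) fun x _ =>
    isBernoulli_compare (y := x) (Or.inl hz)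
  rwa [expect_samp] at this

theorem ensures_compareSamp {z : Fin N} (hz : D z ≠ 0) :
    (compareSamp z).Ensures D fun _ => True :=
  ensures_samp.bind fun _ _ => ensures_compare (Or.inl hz)

theorem IsBernoulli.fail_le_sumRuns {A : CondAlg N ℝ} {p σ : ℝ} (h : IsBernoulli D A p) {n : ℕ}
    (hσ : 2 ≤ σ) (hn : 4 * σ ≤ n * p) :
    (CondAlg.sumRuns n A).fail D (fun s => σ ≤ s) ≤ 1 / 4 := by
  have hnp : 0 < n * p := by linarith
  have hp : 0 < p := by
    rcases h.1.eq_or_lt with h0 | h0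
    · rw [← h0, mul_zero] at hnp; exact absurd hnp (lt_irrefl _)
    · exact h0
  have hn0 : 0 < n := by
    rcases Nat.eq_zero_or_pos n with h0 | h0
    · rw [h0, Nat.cast_zero, zero_mul] at hnp; exact absurd hnp (lt_irrefl _)
    · exact h0
  -- Relative deviation 3/4 from a mean of at least 4σ stays above σ, and Chebyshev gives 16/(9·8) ≤
  -- 1/4.
  have h34 : (0 : ℝ) < 3 / 4 := by norm_num
  refine (fail_mono fun s hs => ?_).trans ((h.fail_sumRuns_abs_le hp h34 hn0).trans ?_)
  · have := (abs_le.1 hs).1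
    linarith
  · rw [div_le_div_iff₀ (by positivity) (by norm_num)]
    linarith

variable [NeZero N]

theorem ensures_unifElem : (unifElem : CondAlg N (Fin N)).Ensures D fun _ => True :=
  fun _ => trivial

theorem expect_unifElem (f : Fin N → ℝ) : unifElem.expect D f = (∑ x, f x) / N := by
  have hN : N - 1 + 1 = N := Nat.sub_add_cancel NeZero.one_le
  rw [unifElem, expect]
  congr 1
  · exact Fintype.sum_equiv (finCongr hN) _ _ fun i => rfl
  · exact_mod_cast hN

theorem isBernoulli_compareUnif {z : Fin N} (hz : D z ≠ 0) :
    IsBernoulli D (compareUnif z) (probUnif D z) := by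
  have := IsBernoulli.bind (c := fun x => compare x z) (ensures_unifElem (D := D)) fun x _ =>
    isBernoulli_compare (x := x) (Or.inr hz)
  rwa [expect_unifElem] at this

theorem ensures_compareUnif {z : Fin N} (hz : D z ≠ 0) :
    (compareUnif z).Ensures D fun _ => True :=
  ensures_unifElem.bind fun _ _ => ensures_compare (Or.inr hz)

/-- The reference is itself a sample, hence has positive mass; this makes every `Pcond` query
involving it legal. -/
theorem ensures_candidate (Q : ℕ) : (candidate Q).Ensures D fun w => D w.1 ≠ 0 :=
  ensures_samp.bind fun _ hz => ((ensures_compareSamp hz).sumRuns Q).bind fun _ _ =>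
    ((ensures_compareUnif hz).sumRuns Q).bind fun _ _ => hz

theorem ensures_select (Q j : ℕ) : (select Q j).Ensures D fun w => D w.1 ≠ 0 := by
  induction j with
  | zero => exact ensures_candidate Q
  | succ j ih =>
    refine ih.bind fun w hw => (ensures_candidate Q).bind fun w' hw' => ?_
    change D (if w.2 < w'.2 then w' else w).1 ≠ 0
    split_ifs
    · exact hw'
    · exact hw

/-- The winner is one of the j + 1 candidates, so a union bound applies. -/
theorem fail_select_le {P : Fin N × ℝ → Prop} (Q j : ℕ) :
    (select Q j).fail D P ≤ (j + 1) * (candidate Q).fail D P := by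
  induction j with
  | zero => simp [select]
  | succ j ih =>
    have h0 : 0 ≤ (candidate Q).fail D P :=
      expect_nonneg D _ fun x => by split_ifs <;> norm_num
    have := fail_bind_le (g := fun w => (candidate Q).bind fun w' =>
      output (if w.2 < w'.2 then w' else w)) (R := P) (ensures_select (D := D) Q j) ih h0
      fun w _ hw => by
        have := fail_bind_le (g := fun w' => output (if w.2 < w'.2 then w' else w)) (R := P)
          (ensures_candidate (D := D) Q) (le_refl ((candidate Q).fail D P)) le_rfl
          fun w' _ hw' => fail_output (by split_ifs <;> assumption)
        simpa using this
    refine this.trans (le_of_eq ?_)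
    push_cast
    ring

/-- The best score is below σ exactly when all the independent scores are. -/
theorem fail_select_score (σ : ℝ) (Q j : ℕ) :
    (select Q j).fail D (fun w => σ ≤ w.2) = (candidate Q).fail D (fun w => σ ≤ w.2) ^ (j + 1) := by
  induction j with
  | zero => simp [select]
  | succ j ih =>
    rw [pow_succ, ← ih]
    simp only [fail, select, expect_bind, expect_output]
    rw [← expect_mul_right]
    congr 1; ext w
    rw [← expect_mul_left]
    congr 1; ext w'
    split_ifs with h1 h2 h3 h4 h5 h6 <;> first | (exfalso; linarith) | norm_num

/-- A candidate rarely has a high score if one of its two success probabilities is low. -/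
theorem fail_candidate_le {Q : ℕ} {σ β : ℝ} (h : Q * β ≤ σ / 4) :
    (candidate Q).fail D (fun w => σ ≤ w.2 → β ≤ min (probSamp D w.1) (probUnif D w.1)) ≤
      Real.exp (-(σ / 2)) := by
  have he := (Real.exp_pos (-(σ / 2))).le
  have hQ : (0 : ℝ) ≤ Q := Nat.cast_nonneg Q
  rw [← zero_add (Real.exp _)]
  refine fail_bind_le (P := fun _ => True) ensures_samp (fail_eq_zero ensures_samp.true) he
    fun z hz _ => ?_
  have es := (ensures_compareSamp hz).sumRuns Q
  have eu := (ensures_compareUnif hz).sumRuns Q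
  by_cases hs : β ≤ probSamp D z
  · rw [← zero_add (Real.exp _)]
    refine fail_bind_le (P := fun _ => True) es (fail_eq_zero es) he fun s _ _ => ?_
    by_cases hu : β ≤ probUnif D z
    · exact (fail_eq_zero (eu.bind fun _ _ => by exact fun _ => le_min hs hu)).trans he
    · rw [← add_zero (Real.exp _)]
      refine fail_bind_le eu ((isBernoulli_compareUnif hz).fail_sumRuns_lt (σ := σ) ?_) le_rfl
        fun s' _ hs' => fail_output fun hc => ?_
      · exact (mul_le_mul_of_nonneg_left (not_le.1 hu).le hQ).trans h
      · exact absurd (hc.trans (min_le_right s s')) (not_le.2 hs')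
  · rw [← add_zero (Real.exp _)]
    refine fail_bind_le es ((isBernoulli_compareSamp hz).fail_sumRuns_lt (σ := σ) ?_) le_rfl
      fun s _ hs' => fail_eq_zero (eu.bind fun s' _ hc => ?_)
    · exact (mul_le_mul_of_nonneg_left (not_le.1 hs).le hQ).trans h
    · exact absurd (hc.trans (min_le_left s s')) (not_le.2 hs')

/-- A reference element with both success probabilities high obtains a high score. -/
theorem fail_candidate_score_le {Q : ℕ} {σ μ δ : ℝ} (hσ : 2 ≤ σ) (hQ : 4 * σ ≤ Q * μ)
    (hδ : δ ≤ ∑ z with μ ≤ min (probSamp D z) (probUnif D z), (D z).toReal) :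
    (candidate Q).fail D (fun w => σ ≤ w.2) ≤ 1 - δ / 2 := by
  classical
  set G : Fin N → Prop := fun z => μ ≤ min (probSamp D z) (probUnif D z)
  have hQ0 : (0 : ℝ) ≤ Q := Nat.cast_nonneg Q
  have key : (candidate Q).fail D (fun w => σ ≤ w.2) ≤
      samp.expect D fun z => 1 - (if G z then 1 else 0) * (1 / 2) := by
    rw [candidate, fail, expect_bind]
    refine ensures_samp.expect_mono fun z hz => ?_
    have es := (ensures_compareSamp hz).sumRuns Q
    have eu := (ensures_compareUnif hz).sumRuns Q
    split_ifs with hG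
    · have hs : 4 * σ ≤ Q * probSamp D z :=
        hQ.trans (mul_le_mul_of_nonneg_left (hG.trans (min_le_left _ _)) hQ0)
      have hu : 4 * σ ≤ Q * probUnif D z :=
        hQ.trans (mul_le_mul_of_nonneg_left (hG.trans (min_le_right _ _)) hQ0)
      have := fail_bind_le (g := fun s => (sumRuns Q (compareUnif z)).bind fun s' =>
          output (z, min s s')) (R := fun w => σ ≤ w.2) es
        ((isBernoulli_compareSamp hz).fail_le_sumRuns hσ hs) (η := 1 / 4 + 0) (by norm_num)
        fun s _ h1 => fail_bind_le eu ((isBernoulli_compareUnif hz).fail_le_sumRuns hσ hu) le_rfl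
          fun s' _ h2 => fail_output (le_min h1 h2)
      refine le_trans ?_ (this.trans (by norm_num))
      unfold fail
      exact le_rfl
    · have : ∀ A : CondAlg N (Fin N × ℝ),
          A.expect D (fun w => if σ ≤ w.2 then 0 else 1) ≤ 1 := fun A => by
        simpa [expect_const] using
          expect_mono D A (g := fun _ => (1 : ℝ)) fun w => by split_ifs <;> norm_num
      rw [zero_mul, sub_zero]
      exact this _
  refine key.trans ?_
  rw [expect_sub, expect_const, expect_mul_right, expect_samp]
  simp only [mul_ite, mul_one, mul_zero, ← Finset.sum_filter]
  linarith

end Law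

end CondAlg

/-! ### The overlap with uniform: good references and exact identities. -/

namespace CondAlg

variable {N : ℕ} {α : Type}

/-- The overlap `∑ min (D i) (1 / N)` of `D` with the uniform distribution. -/
def overlap (D : PMF (Fin N)) : ℝ := ∑ i, min (D i).toReal (1 / N)

section Overlap

variable {D : PMF (Fin N)}

theorem overlap_nonneg : 0 ≤ overlap D :=
  Finset.sum_nonneg fun _ _ => le_min ENNReal.toReal_nonneg (by positivity)

theorem overlap_le_one : overlap D ≤ 1 := by
  rw [← sum_toReal_pmf D]
  exact Finset.sum_le_sum fun _ _ => min_le_left _ _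

theorem half_min_le {x y u : ℝ} (hx : 0 ≤ x) (hu : 0 < u) (h : u ≤ y) :
    min x u / 2 ≤ x * (y / (y + x)) := by
  have hy := hu.trans_le h
  rw [mul_div_assoc', div_le_div_iff₀ (by norm_num) (by positivity)]
  rcases le_total x u with h' | h'
  · rw [min_eq_left h']; nlinarith
  · rw [min_eq_right h']; nlinarith

theorem half_min_le' {x y u : ℝ} (hx : 0 ≤ x) (hu : 0 < u) (hy : 0 ≤ y) (h : y ≤ u) :
    min x u / 2 ≤ x / (x + y) * u := by
  rcases hx.eq_or_lt with h0 | h0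
  · rw [← h0, min_eq_left hu.le]; simp
  rw [div_mul_eq_mul_div, div_le_div_iff₀ (by norm_num) (by positivity)]
  rcases le_total x u with h' | h'
  · rw [min_eq_left h']; nlinarith
  · rw [min_eq_right h']; nlinarith

variable [NeZero N]

theorem dTV_uniform : dTV D (PMF.uniformOfFintype (Fin N)) = 1 - overlap D := by
  have hN : (N : ℝ) ≠ 0 := NeZero.ne _
  have e : ∀ i : Fin N, |(D i).toReal - (PMF.uniformOfFintype (Fin N) i).toReal| =
      (D i).toReal + 1 / N - 2 * min (D i).toReal (1 / N) := by
    intro i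
    rw [PMF.uniformOfFintype_apply, ENNReal.toReal_inv, ENNReal.toReal_natCast, Fintype.card_fin,
      ← one_div]
    rcases le_total (D i).toReal (1 / N) with h | h
    · rw [min_eq_left h, abs_of_nonpos (by linarith)]; ring
    · rw [min_eq_right h, abs_of_nonneg (by linarith)]; ring
  rw [dTV, overlap]
  simp only [e, Finset.sum_sub_distrib, Finset.sum_add_distrib, sum_toReal_pmf, ← Finset.mul_sum,
    Finset.sum_const, Finset.card_univ, Fintype.card_fin, nsmul_eq_mul]
  field_simp
  ring

/-- Both sums consist of the terms D(x)/(D(x) + D(z)), up to the factor D(z) and the normalisation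
by N. -/
theorem probSamp_eq (z : Fin N) : probSamp D z = N * (D z).toReal * probUnif D z := by
  have hN : (N : ℝ) ≠ 0 := NeZero.ne _
  rw [probSamp, probUnif, Finset.sum_div, Finset.mul_sum]
  refine Finset.sum_congr rfl fun x _ => ?_
  rw [add_comm (D z).toReal]
  field_simp

/-- Good reference elements have substantial mass. -/
theorem overlap_le_sum_good : overlap D / 4 ≤
    ∑ z with overlap D / 8 ≤ min (probSamp D z) (probUnif D z), (D z).toReal := by
  set t := overlap D with ht
  set u : ℝ := 1 / N with hu_def
  have hN : (0 : ℝ) < N := by exact_mod_cast NeZero.pos N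
  have hu : 0 < u := by positivity
  have d0 : ∀ x, 0 ≤ (D x).toReal := fun x => ENNReal.toReal_nonneg
  have t0 : 0 ≤ t := overlap_nonneg
  have hpu : ∀ z, probUnif D z = ∑ x, (D x).toReal / ((D x).toReal + (D z).toReal) * u :=
    fun z => by rw [probUnif, ← Finset.sum_mul, hu_def, mul_one_div]
  have ha : ∀ z, u ≤ (D z).toReal → t / 2 ≤ probSamp D z := by
    intro z hz
    rw [ht, overlap, Finset.sum_div, probSamp]
    exact Finset.sum_le_sum fun x _ => half_min_le (d0 x) hu hz
  have hb : ∀ z, (D z).toReal ≤ u → t / 2 ≤ probUnif D z := by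
    intro z hz
    rw [ht, overlap, Finset.sum_div, hpu]
    exact Finset.sum_le_sum fun x _ => half_min_le' (d0 x) hu (d0 z) hz
  -- Either the light or the heavy elements supply half of t. Each class has one success probability
  -- at least t/2 automatically (`ha`, `hb`), so only the other one must be controlled.
  have hsplit : t = ∑ z with (D z).toReal < u, (D z).toReal + ∑ z with ¬ (D z).toReal < u, u := by
    rw [ht, overlap, ← Finset.sum_filter_add_sum_filter_not _ fun z => (D z).toReal < u]
    congr 1
    · exact Finset.sum_congr rfl fun z hz => min_eq_left (Finset.mem_filter.1 hz).2.le
    · exact Finset.sum_congr rfl fun z hz => min_eq_right (not_lt.1 (Finset.mem_filter.1 hz).2)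
  rcases le_total (t / 2) (∑ z with (D z).toReal < u, (D z).toReal) with h | h
  · have hbad : ∑ z with (D z).toReal < u ∧ ¬ t / 8 ≤ probSamp D z, (D z).toReal ≤ t / 4 := by
      rcases (Finset.univ.filter fun z => (D z).toReal < u ∧
        ¬ t / 8 ≤ probSamp D z).eq_empty_or_nonempty with he | hne
      · rw [he, Finset.sum_empty]; positivity
      -- The heaviest bad element beats every bad one with probability at least 1/2, so `probSamp D
      -- z` is at least half the bad mass; being bad, it is below t/8.
      obtain ⟨z, hz, hmax⟩ := Finset.exists_max_image _ (fun z => (D z).toReal) hne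
      have hz2 := (Finset.mem_filter.1 hz).2.2
      have : (∑ x with (D x).toReal < u ∧ ¬ t / 8 ≤ probSamp D x, (D x).toReal) * (1 / 2) ≤
          probSamp D z := by
        rw [Finset.sum_mul, probSamp]
        refine (Finset.sum_le_sum fun x hx => ?_).trans (Finset.sum_le_sum_of_subset_of_nonneg
          (Finset.subset_univ _) fun x _ _ => by positivity)
        have hxz := hmax x hx
        rcases (d0 x).eq_or_lt with h0 | h0
        · rw [← h0]; simp
        · refine mul_le_mul_of_nonneg_left ?_ h0.le
          rw [div_le_div_iff₀ (by norm_num) (by linarith)]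
          linarith
      push Not at hz2
      linarith
    have hcover : ∑ z with (D z).toReal < u, (D z).toReal ≤
        (∑ z with (D z).toReal < u ∧ ¬ t / 8 ≤ probSamp D z, (D z).toReal) +
          ∑ z with t / 8 ≤ min (probSamp D z) (probUnif D z), (D z).toReal := by
      simp only [Finset.sum_filter, ← Finset.sum_add_distrib]
      refine Finset.sum_le_sum fun z _ => ?_
      have := d0 z
      by_cases h1 : (D z).toReal < u
      · by_cases h2 : t / 8 ≤ probSamp D z
        · have : t / 8 ≤ min (probSamp D z) (probUnif D z) :=
            le_min h2 (le_trans (by linarith) (hb z h1.le))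
          simp [h1, h2, this]
        · simp only [h1, h2, not_false_eq_true, and_self, if_true]
          split_ifs <;> linarith
      · simp only [h1, false_and, if_false]
        split_ifs <;> linarith
    linarith
  · have h' : t / 2 ≤ ∑ z with ¬ (D z).toReal < u, u := by linarith
    have hbad : ∑ z with ¬ (D z).toReal < u ∧ ¬ t / 8 ≤ probUnif D z, u ≤ t / 4 := by
      rcases (Finset.univ.filter fun z => ¬ (D z).toReal < u ∧
        ¬ t / 8 ≤ probUnif D z).eq_empty_or_nonempty with he | hne
      · rw [he, Finset.sum_empty]; positivity
      -- Dually, the lightest bad element loses to every bad one with probability at least 1/2.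
      obtain ⟨z, hz, hmin⟩ := Finset.exists_min_image _ (fun z => (D z).toReal) hne
      have hz1 := not_lt.1 (Finset.mem_filter.1 hz).2.1
      have hz2 := (Finset.mem_filter.1 hz).2.2
      have : (∑ x with ¬ (D x).toReal < u ∧ ¬ t / 8 ≤ probUnif D x, u) * (1 / 2) ≤
          probUnif D z := by
        rw [Finset.sum_mul, hpu]
        refine (Finset.sum_le_sum fun x hx => ?_).trans (Finset.sum_le_sum_of_subset_of_nonneg
          (Finset.subset_univ _) fun x _ _ => by positivity)
        have hxz := hmin x hx
        rw [mul_comm u]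
        refine mul_le_mul_of_nonneg_right ?_ hu.le
        rw [div_le_div_iff₀ (by norm_num) (by linarith)]
        linarith
      push Not at hz2
      linarith
    have hcover : ∑ z with ¬ (D z).toReal < u, u ≤
        (∑ z with ¬ (D z).toReal < u ∧ ¬ t / 8 ≤ probUnif D z, u) +
          ∑ z with t / 8 ≤ min (probSamp D z) (probUnif D z), (D z).toReal := by
      simp only [Finset.sum_filter, ← Finset.sum_add_distrib]
      refine Finset.sum_le_sum fun z _ => ?_
      have := d0 z
      by_cases h1 : (D z).toReal < u
      · simp only [h1, not_true_eq_false, false_and, if_false]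
        split_ifs <;> linarith
      · by_cases h2 : t / 8 ≤ probUnif D z
        · have : t / 8 ≤ min (probSamp D z) (probUnif D z) :=
            le_min (le_trans (by linarith) (ha z (not_lt.1 h1))) h2
          simp only [h1, h2, this, not_false_eq_true, not_true_eq_false, and_false, if_true,
            if_false]
          linarith
        · simp only [h1, h2, not_false_eq_true, and_self, if_true]
          split_ifs <;> linarith
    linarith

/-- By `probSamp_eq` the ratio is 1/(N·D(z)), so the truncated odds equal min(N·D(x), 1). -/
theorem expect_cutRatio_unifElem {z : Fin N} (hz : D z ≠ 0) (hb : 0 < probUnif D z) :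
    unifElem.expect D (fun x => cutRatio (probUnif D z / probSamp D z)
      ((D x).toReal / ((D x).toReal + (D z).toReal))) = overlap D := by
  have hN : (0 : ℝ) < N := by exact_mod_cast NeZero.pos N
  have hd := toReal_pos hz
  rw [expect_unifElem, overlap, Finset.sum_div, probSamp_eq]
  refine Finset.sum_congr rfl fun x _ => ?_
  have hx : 0 ≤ (D x).toReal := ENNReal.toReal_nonneg
  generalize (D x).toReal = y at hx
  generalize (D z).toReal = c at hd
  have hyc : 0 < y + c := by linarith
  have e : probUnif D z / (N * c * probUnif D z) * (1 - y / (y + c)) = (1 / N) / (y + c) := by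
    field_simp; ring
  rw [cutRatio, e, max_eq_left (by positivity), max_div_div_right hyc.le,
    div_div_div_cancel_right₀ hyc.ne']
  rcases le_total y (1 / N) with h | h
  · rw [max_eq_right h, min_eq_left h]; field_simp
  · have hy : 0 < y := lt_of_lt_of_le (by positivity) h
    rw [max_eq_left h, min_eq_right h]; field_simp

/-- Here the ratio is N·D(z), the truncated odds are min(1/(N·D(x)), 1) when D(x) > 0, and weighting
by D(x) gives min(D(x), 1/N). -/
theorem expect_cutRatio_samp {z : Fin N} (hz : D z ≠ 0) (hb : 0 < probUnif D z) :
    samp.expect D (fun x => cutRatio (probSamp D z / probUnif D z)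
      ((D z).toReal / ((D z).toReal + (D x).toReal))) = overlap D := by
  have hN : (0 : ℝ) < N := by exact_mod_cast NeZero.pos N
  have hd := toReal_pos hz
  rw [expect_samp, overlap, probSamp_eq]
  refine Finset.sum_congr rfl fun x _ => ?_
  have hx : 0 ≤ (D x).toReal := ENNReal.toReal_nonneg
  generalize (D x).toReal = y at hx
  generalize (D z).toReal = c at hd
  have hyc : 0 < c + y := by linarith
  have e : N * c * probUnif D z / probUnif D z * (1 - c / (c + y)) = N * c * y / (c + y) := by
    field_simp; ring
  rw [cutRatio, e, max_eq_left (by positivity), max_div_div_right hyc.le,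
    div_div_div_cancel_right₀ hyc.ne']
  rcases le_total y (1 / N) with h | h
  · have h' : N * c * y ≤ c := by
      have : N * y ≤ 1 := by rw [le_div_iff₀ hN] at h; linarith
      nlinarith
    rw [max_eq_left h', min_eq_left h]; field_simp
  · have h' : c ≤ N * c * y := by
      have : 1 ≤ N * y := by rw [div_le_iff₀ hN] at h; linarith
      nlinarith
    have hy : 0 < y := lt_of_lt_of_le (by positivity) h
    rw [max_eq_right h', min_eq_right h]; field_simp

end Overlap

end CondAlg

/-- A relative error in ρ causes at most the same relative error in the truncated ratio, hence in
its mean. -/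
theorem cutRatio_le_mul {ρ ρ' k p : ℝ} (hρ : 0 < ρ) (hk : 1 ≤ k) (h : ρ ≤ k * ρ') (hρ' : 0 < ρ')
    (hp : 0 ≤ p) (hp1 : p ≤ 1) : cutRatio ρ' p ≤ k * cutRatio ρ p := by
  have g := cutRatio_denom_pos hρ p
  have g' := cutRatio_denom_pos hρ' p
  rw [cutRatio, cutRatio, max_eq_left hp, mul_div_assoc', div_le_div_iff₀ g' g]
  have : max p (ρ * (1 - p)) ≤ k * max p (ρ' * (1 - p)) := by
    refine max_le ?_ ?_
    · nlinarith [le_max_left p (ρ' * (1 - p))]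
    · nlinarith [le_max_right p (ρ' * (1 - p))]
  nlinarith

/-! ### The full estimator: parameters and query bound. -/

namespace CondAlg

variable {N : ℕ} {α : Type}

/-- The number of levels used with accuracy `ε` and ratio `ρ`. -/
def levels (ε ρ : ℝ) : ℕ := Nat.clog 2 ⌈2 ^ 21 * ρ / ε ^ 2⌉₊

/-- Restriction of an estimated ratio to `[ε / 256, 1]`. -/
def clip (ε x : ℝ) : ℝ := max (ε / 256) (min 1 x)

/-- Estimates one minus the mean of `cutRatio (clip ε x)`. -/
def estimateDist (ε : ℝ) (smp : CondAlg N α) (c : α → CondAlg N ℝ) (x : ℝ) : CondAlg N ℝ :=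
  (multilevel smp c (clip ε x) (levels ε (clip ε x))).bind fun T => output (1 - T)

/-- The number of candidate reference elements, minus one. -/
def numCandidates (ε : ℝ) : ℕ := ⌈32 / ε⌉₊

/-- The number of comparisons of each kind per candidate reference element. -/
def numTrials (ε : ℝ) : ℕ := ⌈512 * (1 + Real.log ε⁻¹) / ε⌉₊

/-- The number of comparisons of each kind for the final reference element. -/
def numFlips (ε : ℝ) : ℕ := ⌈2 ^ 20 / ε ^ 2⌉₊

/-- The estimation phase with reference element `z`. -/
def estimateWith [NeZero N] (ε : ℝ) (z : Fin N) : CondAlg N ℝ :=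
  (sumRuns (numFlips ε) (compareSamp z)).bind fun a =>
    (sumRuns (numFlips ε) (compareUnif z)).bind fun b =>
      if b ≤ a then estimateDist ε unifElem (fun x => compare x z) (b / a)
      else estimateDist ε samp (fun x => compare z x) (a / b)

/-- The tolerant uniformity tester on a nonempty domain. -/
def estimator [NeZero N] (ε : ℝ) : CondAlg N ℝ :=
  (select (numTrials ε) (numCandidates ε)).bind fun w =>
    if w.2 < numTrials ε * ε / 32 then output 1 else estimateWith ε w.1

section Syntactic

variable {ε : ℝ}

theorem isPairCond_estimateDist {smp : CondAlg N α} {c : α → CondAlg N ℝ} (hs : smp.IsPairCond)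
    (hc : ∀ x, (c x).IsPairCond) (x : ℝ) : (estimateDist ε smp c x).IsPairCond :=
  isPairCond_bind (isPairCond_multilevel hs hc _) fun _ => trivial

theorem isPairCond_estimator [NeZero N] : (estimator ε : CondAlg N ℝ).IsPairCond := by
  refine isPairCond_bind (isPairCond_select _ _) fun w => ?_
  split_ifs
  · trivial
  · refine isPairCond_bind (isPairCond_sumRuns (isPairCond_compareSamp _) _) fun a =>
      isPairCond_bind (isPairCond_sumRuns (isPairCond_compareUnif _) _) fun b => ?_
    split_ifs
    · exact isPairCond_estimateDist isPairCond_unifElem (fun x => isPairCond_compare _ _) _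
    · exact isPairCond_estimateDist isPairCond_samp (fun x => isPairCond_compare _ _) _

theorem clip_pos (hε : 0 < ε) (x : ℝ) : 0 < clip ε x := lt_max_of_lt_left (by positivity)

theorem clip_le_one (hε1 : ε ≤ 1) (x : ℝ) : clip ε x ≤ 1 :=
  max_le (by linarith) (min_le_left _ _)

theorem log_inv_nonneg (hε : 0 < ε) (hε1 : ε ≤ 1) : 0 ≤ Real.log ε⁻¹ :=
  Real.log_nonneg ((one_le_inv₀ hε).2 hε1)

theorem le_two_pow_levels (ρ : ℝ) : 2 ^ 21 * ρ / ε ^ 2 ≤ 2 ^ levels ε ρ := by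
  refine (Nat.le_ceil _).trans ?_
  have h := (Nat.cast_le (α := ℝ)).2
    (Nat.le_pow_clog (b := 2) (by norm_num) ⌈2 ^ 21 * ρ / ε ^ 2⌉₊)
  rwa [Nat.cast_pow, Nat.cast_ofNat] at h

theorem two_pow_levels_clip_le (hε : 0 < ε) (hε1 : ε ≤ 1) (x : ℝ) :
    (2 : ℝ) ^ levels ε (clip ε x) ≤ 2 ^ 23 * clip ε x / ε ^ 2 := by
  have hρ : ε / 256 ≤ clip ε x := le_max_left _ _
  set ρ := clip ε x
  -- The lower clip ε/256 keeps this quantity away from 0, so rounding to an integer and then to a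
  -- power of two loses at most a factor 2 each.
  have hy : 2 ≤ 2 ^ 21 * ρ / ε ^ 2 := by
    rw [le_div_iff₀ (by positivity)]
    nlinarith
  have hc : (⌈2 ^ 21 * ρ / ε ^ 2⌉₊ : ℝ) < 2 ^ 21 * ρ / ε ^ 2 + 1 := Nat.ceil_lt_add_one (by linarith)
  have h1 : 1 < ⌈2 ^ 21 * ρ / ε ^ 2⌉₊ := Nat.lt_ceil.2 (by push_cast; linarith)
  have h2 := Nat.pow_pred_clog_lt_self (b := 2) (by norm_num) h1
  have h3 : 1 ≤ levels ε ρ := Nat.clog_pos (by norm_num) h1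
  have h4 : (2 : ℝ) ^ (levels ε ρ - 1) < ⌈2 ^ 21 * ρ / ε ^ 2⌉₊ := by
    have h := (Nat.cast_lt (α := ℝ)).2 h2
    rwa [Nat.cast_pow, Nat.cast_ofNat] at h
  have h5 : (2 : ℝ) ^ levels ε ρ = 2 * 2 ^ (levels ε ρ - 1) := by
    rw [← pow_succ', Nat.sub_add_cancel h3]
  rw [h5]
  calc _ ≤ 2 * (2 ^ 21 * ρ / ε ^ 2 + 2 ^ 21 * ρ / ε ^ 2) := by linarith
    _ = _ := by ring

theorem levels_clip_le (hε : 0 < ε) (hε1 : ε ≤ 1) (x : ℝ) :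
    (levels ε (clip ε x) : ℝ) + 1 ≤ 24 * (1 + Real.log ε⁻¹) := by
  have h := two_pow_levels_clip_le hε hε1 x
  have hl := log_inv_nonneg hε hε1
  have h2 : (2 : ℝ) ^ levels ε (clip ε x) ≤ 2 ^ 23 * (ε⁻¹) ^ 2 := by
    refine h.trans ?_
    rw [inv_pow, ← div_eq_mul_inv]
    gcongr
    have := clip_le_one hε1 x
    linarith
  have h3 := Real.log_le_log (by positivity) h2
  rw [Real.log_mul (by positivity) (by positivity), Real.log_pow, Real.log_pow, Real.log_pow] at h3
  have hlog : (2 / 3 : ℝ) ≤ Real.log 2 := by linarith [Real.log_two_gt_d9]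
  push_cast at h3
  nlinarith

theorem queries_estimateDist_le (hε : 0 < ε) (hε1 : ε ≤ 1) {smp : CondAlg N α}
    {c : α → CondAlg N ℝ} (hs : smp.queries ≤ 1) (hc : ∀ x, (c x).queries ≤ 1) (x : ℝ) :
    (estimateDist ε smp c x).queries ≤
      ⌊(2 : ℝ) ^ 35 * (ε⁻¹ ^ 2 * (1 + Real.log ε⁻¹) ^ 2)⌋₊ := by
  have hρ := clip_pos hε x
  have hρ1 := clip_le_one hε1 x
  have hl := log_inv_nonneg hε hε1
  refine (queries_bind_le (q := 0) (queries_multilevel_le hs hc hρ (levels ε (clip ε x)))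
    fun _ => le_rfl).trans (Nat.le_floor ?_)
  have hceil : (⌈1 / clip ε x⌉₊ : ℝ) ≤ 2 / clip ε x := by
    have h1 := (Nat.ceil_lt_add_one (a := 1 / clip ε x) (by positivity)).le
    have h2 : 1 ≤ 1 / clip ε x := (one_le_div hρ).2 hρ1
    calc _ ≤ 1 / clip ε x + 1 / clip ε x := by linarith
      _ = _ := by ring
  push_cast
  rw [add_zero]
  -- The factor 2/ρ for the base number of flips cancels the ρ in 2^K.
  calc _ ≤ 3 * (24 * (1 + Real.log ε⁻¹)) ^ 2 *
        (2 / clip ε x * (2 ^ 23 * clip ε x / ε ^ 2)) := by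
        gcongr
        · exact levels_clip_le hε hε1 x
        · exact two_pow_levels_clip_le hε hε1 x
    _ = (3 * 24 ^ 2 * 2 ^ 24) * (ε⁻¹ ^ 2 * (1 + Real.log ε⁻¹) ^ 2) := by
        field_simp
    _ ≤ _ := by gcongr; norm_num

theorem queries_estimator_le [NeZero N] (hε : 0 < ε) (hε1 : ε ≤ 1) :
    ((estimator ε : CondAlg N ℝ).queries : ℝ) ≤
      2 ^ 36 * (ε⁻¹ ^ 2 * (1 + Real.log ε⁻¹) ^ 2) := by
  have hl := log_inv_nonneg hε hε1
  have hi : 1 ≤ ε⁻¹ := (one_le_inv₀ hε).2 hε1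
  set L := 1 + Real.log ε⁻¹ with hL
  have hL1 : 1 ≤ L := by linarith
  have key : (estimator ε : CondAlg N ℝ).queries ≤ (numCandidates ε + 1) * (1 + 3 * numTrials ε) +
      (numFlips ε * 2 + (numFlips ε * 1 + ⌊(2 : ℝ) ^ 35 * (ε⁻¹ ^ 2 * L ^ 2)⌋₊)) := by
    refine queries_bind_le (queries_select_le _ _) fun w => ?_
    split_ifs
    · exact Nat.zero_le _
    · refine queries_bind_le (queries_sumRuns_le (queries_compareSamp_le _) _) fun a =>
        queries_bind_le (queries_sumRuns_le (queries_compareUnif_le _) _) fun b => ?_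
      split_ifs
      · exact queries_estimateDist_le hε hε1 (queries_unifElem_le.trans zero_le_one)
          (fun x => queries_compare_le _ _) _
      · exact queries_estimateDist_le hε hε1 queries_samp_le (fun x => queries_compare_le _ _) _
  have key' := (Nat.cast_le (α := ℝ)).2 key
  push_cast at key'
  refine key'.trans ?_
  have hJ : (numCandidates ε : ℝ) + 1 ≤ 34 * ε⁻¹ := by
    have := (Nat.ceil_lt_add_one (a := 32 / ε) (by positivity)).le
    rw [div_eq_mul_inv] at this
    unfold numCandidates
    rw [div_eq_mul_inv]
    linarith
  have hiL : 1 ≤ L * ε⁻¹ := by nlinarith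
  have hQ : 1 + 3 * (numTrials ε : ℝ) ≤ 1540 * (L * ε⁻¹) := by
    have := (Nat.ceil_lt_add_one (a := 512 * L / ε) (by positivity)).le
    rw [mul_div_assoc, div_eq_mul_inv L] at this
    unfold numTrials
    rw [← hL, mul_div_assoc, div_eq_mul_inv L]
    linarith
  have hi2 : 1 ≤ ε⁻¹ ^ 2 := one_le_pow₀ hi
  have hn : (numFlips ε : ℝ) ≤ 2 ^ 21 * ε⁻¹ ^ 2 := by
    have := (Nat.ceil_lt_add_one (a := 2 ^ 20 / ε ^ 2) (by positivity)).le
    unfold numFlips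
    rw [div_eq_mul_inv, ← inv_pow] at this ⊢
    linarith
  have hfl := Nat.floor_le (a := (2 : ℝ) ^ 35 * (ε⁻¹ ^ 2 * L ^ 2)) (by positivity)
  have hX1 : ε⁻¹ ^ 2 ≤ ε⁻¹ ^ 2 * L ^ 2 := le_mul_of_one_le_right (by positivity) (one_le_pow₀ hL1)
  have hX2 : ε⁻¹ ^ 2 * L ≤ ε⁻¹ ^ 2 * L ^ 2 := by
    gcongr
    nlinarith
  have hJQ : ((numCandidates ε : ℝ) + 1) * (1 + 3 * numTrials ε) ≤
      34 * ε⁻¹ * (1540 * (L * ε⁻¹)) := by gcongr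
  have e : 34 * ε⁻¹ * (1540 * (L * ε⁻¹)) = 52360 * (ε⁻¹ ^ 2 * L) := by ring
  linarith

end Syntactic

/-! ### Accuracy of the estimator. -/

section Law

variable {D : PMF (Fin N)} {ε : ℝ}

theorem Ensures.estimateDist {smp : CondAlg N α} {c : α → CondAlg N ℝ}
    (hs : smp.Ensures D fun _ => True) (hc : ∀ x, (c x).Ensures D fun _ => True) (x : ℝ) :
    (estimateDist ε smp c x).Ensures D fun _ => True :=
  (hs.multilevel hc _).bind fun _ _ => trivial

theorem ensures_estimator [NeZero N] : (estimator ε).Ensures D fun _ => True := by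
  refine (ensures_select _ _).bind fun w hw => ?_
  split_ifs
  · trivial
  · refine ((ensures_compareSamp hw).sumRuns _).bind fun a _ =>
      ((ensures_compareUnif hw).sumRuns _).bind fun b _ => ?_
    split_ifs
    · exact ensures_unifElem.estimateDist (fun x => ensures_compare (Or.inr hw)) _
    · exact ensures_samp.true.estimateDist (fun x => ensures_compare (Or.inl hw)) _

/-- The second phase is accurate, given good estimates `a'`, `b'` of the success probabilities
`a`, `b` of the two comparisons with the reference element. -/
theorem fail_estimateDist_le {smp : CondAlg N α} {c : α → CondAlg N ℝ} {p : α → ℝ}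
    (hs : smp.Ensures D fun _ => True) (hcs : ∀ x, (c x).Ensures D fun _ => True)
    (hc : ∀ x, IsBernoulli D (c x) (p x)) {t τ a b a' b' n : ℝ} (hε : 0 < ε) (hετ : ε ≤ τ)
    (ht0 : 0 ≤ t) (htτ : t ≤ τ) (ha0 : 0 < a) (ha : a ≤ 1) (hb : τ / 128 ≤ b)
    (hΦ : smp.expect D (fun x => cutRatio (b / a) (p x)) = t) (hn : 0 < n)
    (hA : |a' - n * a| ≤ ε / (20 * τ) * (n * a)) (hB : |b' - n * b| ≤ ε / (20 * τ) * (n * b))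
    (hba : b' ≤ a') :
    (estimateDist ε smp c (b' / a')).fail D (fun v => |v - (1 - t)| ≤ ε) ≤ 1 / 32 := by
  have hτ : 0 < τ := hε.trans_le hετ
  have hb0 : 0 < b := by linarith [div_pos hτ (by norm_num : (0 : ℝ) < 128)]
  set δ := ε / (20 * τ) with hδ
  have hδτ : δ * τ = ε / 20 := by rw [hδ]; field_simp
  have hδ0 : 0 < δ := by positivity
  have hδ1 : δ ≤ 1 / 20 := by
    rw [hδ, div_le_div_iff₀ (by positivity) (by norm_num)]; linarith
  obtain ⟨hA1, hA2⟩ := abs_le.1 hA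
  obtain ⟨hB1, hB2⟩ := abs_le.1 hB
  have hna : 0 < n * a := by positivity
  have hnb : 0 < n * b := by positivity
  have ha'1 : (1 - δ) * (n * a) ≤ a' := by linarith
  have hb'1 : (1 - δ) * (n * b) ≤ b' := by linarith
  have ha'2 : a' ≤ (1 + δ) * (n * a) := by linarith
  have hb'2 : b' ≤ (1 + δ) * (n * b) := by linarith
  have ha'0 : 0 < a' := lt_of_lt_of_le (by nlinarith) ha'1
  have hb'0 : 0 < b' := lt_of_lt_of_le (by nlinarith) hb'1
  -- Bounds (1 + δ)/(1 - δ), the worst distortion of a quotient of two estimates with relative error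
  -- δ.
  set k := 1 + 3 * δ with hk
  have hkδ : 1 + δ ≤ k * (1 - δ) := by rw [hk]; nlinarith
  have hk0 : 0 < k := by linarith
  set ρ := b' / a' with hρdef
  set ρ₀ := b / a with hρ₀def
  have hρ0 : 0 < ρ := by positivity
  have hρ₀0 : 0 < ρ₀ := by positivity
  have r1 : ρ ≤ k * ρ₀ := by
    rw [hρdef, hρ₀def, mul_div_assoc', div_le_div_iff₀ ha'0 ha0]
    have h1 : b' * a ≤ (1 + δ) * (n * b) * a := by gcongr
    have h2 : k * b * ((1 - δ) * (n * a)) ≤ k * b * a' := by gcongr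
    have h3 : (1 + δ) * (n * a * b) ≤ k * (1 - δ) * (n * a * b) := by gcongr
    linarith
  have r2 : ρ₀ ≤ k * ρ := by
    rw [hρdef, hρ₀def, mul_div_assoc', div_le_div_iff₀ ha0 ha'0]
    have h1 : b * a' ≤ b * ((1 + δ) * (n * a)) := by gcongr
    have h2 : k * ((1 - δ) * (n * b)) * a ≤ k * b' * a := by gcongr
    have h3 : (1 + δ) * (n * a * b) ≤ k * (1 - δ) * (n * a * b) := by gcongr
    linarith
  have hρ1 : ρ ≤ 1 := div_le_one_of_le₀ hba ha'0.le
  have hbρ : b ≤ ρ₀ := by rw [hρ₀def, le_div_iff₀ ha0]; nlinarith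
  have hρτ : τ / 256 ≤ ρ := by
    have hk2 : k ≤ 2 := by linarith
    have : k * ρ ≤ 2 * ρ := by gcongr
    linarith
  -- Clipping is inactive here; it only protects the worst-case query bound in bad executions.
  have hclip : clip ε ρ = ρ := by
    rw [clip, min_eq_right hρ1, max_eq_right (by linarith)]
  set Φ := smp.expect D fun x => cutRatio ρ (p x) with hΦdef
  have hΦ1 : Φ ≤ k * t := by
    rw [hΦdef, ← hΦ, ← expect_mul_left]
    exact expect_mono D _ fun x => cutRatio_le_mul hρ₀0 (by linarith) r2 hρ0 (hc x).1 (hc x).2.1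
  have hΦ2 : t ≤ k * Φ := by
    rw [hΦdef, ← hΦ, ← expect_mul_left]
    exact expect_mono D _ fun x => cutRatio_le_mul hρ0 (by linarith) r1 hρ₀0 (hc x).1 (hc x).2.1
  have hδt : δ * t ≤ ε / 20 := by rw [← hδτ]; gcongr
  have hΦt : |Φ - t| ≤ ε / 2 := by
    rw [abs_le]
    constructor
    · have hΦ3 : δ * Φ ≤ δ * (2 * t) := by
        gcongr
        nlinarith
      rw [hk] at hΦ2
      linarith
    · rw [hk] at hΦ1
      linarith
  have hk3 : k ≤ 23 / 20 := by linarith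
  -- Combines Φ ≤ kt ≤ kτ with τ/128 ≤ b ≤ ρ₀ ≤ kρ. This is where the quality of the reference
  -- element pays off.
  have hΦρ : Φ ≤ 256 * ρ := by
    have h1 : k * ρ ≤ 23 / 20 * ρ := by gcongr
    have h2 : k * t ≤ 23 / 20 * t := by gcongr
    linarith
  have hsq := expect_multilevel_sq_le (smp := smp) hc hρ0 hρ1 (levels ε ρ)
  rw [← hΦdef] at hsq
  have hlev := le_two_pow_levels (ε := ε) ρ
  rw [div_le_iff₀ (by positivity)] at hlev
  -- The constant 2^21 in `levels` is 32·4·64·256.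
  have hv : 64 * Φ / 2 ^ levels ε ρ / (ε / 2) ^ 2 ≤ 1 / 32 := by
    rw [div_div, div_le_div_iff₀ (by positivity) (by norm_num)]
    linarith
  rw [estimateDist, hclip, ← add_zero (1 / 32 : ℝ)]
  refine fail_bind_le (P := fun y => |y - Φ| ≤ ε / 2) (hs.multilevel hcs _)
    ((fail_le_of_sq hsq (half_pos hε)).trans hv) le_rfl fun y _ hy => fail_output ?_
  have := abs_le.1 hy
  have := abs_le.1 hΦt
  rw [abs_le]
  constructor <;> linarith

theorem fail_estimateWith_le [NeZero N] {z : Fin N} (hz : D z ≠ 0) {τ : ℝ} (hε : 0 < ε)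
    (hετ : ε ≤ τ) (hτ1 : τ ≤ 1) (htτ : overlap D ≤ τ)
    (hzτ : τ / 128 ≤ min (probSamp D z) (probUnif D z)) :
    (estimateWith ε z).fail D (fun v => |v - (1 - overlap D)| ≤ ε) ≤ 1 / 20 + (1 / 20 + 1 / 32) := by
  have hτ : 0 < τ := hε.trans_le hετ
  have hs := isBernoulli_compareSamp hz
  have hu := isBernoulli_compareUnif hz
  have hsτ := hzτ.trans (min_le_left _ _)
  have huτ := hzτ.trans (min_le_right _ _)
  have hτ128 : 0 < τ / 128 := by positivity
  have hs0 := hτ128.trans_le hsτ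
  have hu0 := hτ128.trans_le huτ
  have hn : 0 < numFlips ε := Nat.ceil_pos.2 (by positivity)
  have hn' : (0 : ℝ) < numFlips ε := by exact_mod_cast hn
  have hnε : 2 ^ 20 ≤ numFlips ε * ε ^ 2 := by
    rw [← div_le_iff₀ (by positivity)]
    exact Nat.le_ceil _
  set n := numFlips ε with hndef
  have hδ : 0 < ε / (20 * τ) := by positivity
  -- The relative accuracy ε/(20τ) suffices because Φ is of order at most τ; with q ≥ τ/128 it costs
  -- only order τ/ε² flips.
  have hvar : ∀ q, τ / 128 ≤ q → 1 / ((ε / (20 * τ)) ^ 2 * (n * q)) ≤ 1 / 20 := by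
    intro q hq
    refine one_div_le_one_div_of_le (by norm_num) ?_
    calc (20 : ℝ) ≤ 2 ^ 20 / (400 * 128) := by norm_num
      _ ≤ n * ε ^ 2 / (400 * 128) := by gcongr
      _ ≤ n * ε ^ 2 / (400 * 128) * (1 / τ) :=
        le_mul_of_one_le_right (by positivity) ((one_le_div hτ).2 hτ1)
      _ = (ε / (20 * τ)) ^ 2 * (n * (τ / 128)) := by field_simp; norm_num
      _ ≤ _ := by gcongr
  refine fail_bind_le ((ensures_compareSamp hz).sumRuns n)
    ((hs.fail_sumRuns_abs_le hs0 hδ hn).trans (hvar _ hsτ)) (by norm_num) fun a _ ha => ?_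
  refine fail_bind_le ((ensures_compareUnif hz).sumRuns n)
    ((hu.fail_sumRuns_abs_le hu0 hδ hn).trans (hvar _ huτ)) (by norm_num) fun b _ hb => ?_
  split_ifs with hba
  · exact fail_estimateDist_le ensures_unifElem (fun x => ensures_compare (Or.inr hz))
      (fun x => isBernoulli_compare (Or.inr hz)) hε hετ overlap_nonneg htτ hs0 hs.2.1 huτ
      (expect_cutRatio_unifElem hz hu0) hn' ha hb hba
  · exact fail_estimateDist_le ensures_samp.true (fun x => ensures_compare (Or.inl hz))
      (fun x => isBernoulli_compare (Or.inl hz)) hε hετ overlap_nonneg htτ hu0 hu.2.1 hsτ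
      (expect_cutRatio_samp hz hu0) hn' hb ha (not_le.1 hba).le

/-- The reference element selected in the first phase is good, or the overlap is small. -/
theorem fail_select_numTrials_le [NeZero N] (hε : 0 < ε) (hε1 : ε ≤ 1) :
    (select (numTrials ε) (numCandidates ε)).fail D (fun w =>
      (w.2 < numTrials ε * ε / 32 → overlap D ≤ ε) ∧
      (numTrials ε * ε / 32 ≤ w.2 →
        max (overlap D) ε / 128 ≤ min (probSamp D w.1) (probUnif D w.1))) ≤ 1 / 50 + 1 / 50 := by
  have hl := log_inv_nonneg hε hε1
  have hσε : 16 * (1 + Real.log ε⁻¹) ≤ numTrials ε * ε / 32 := by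
    have h : 512 * (1 + Real.log ε⁻¹) / ε ≤ numTrials ε := Nat.le_ceil _
    rw [div_le_iff₀ hε] at h
    linarith
  have hJ : 32 / ε ≤ numCandidates ε := Nat.le_ceil _
  have hJ2 : (numCandidates ε : ℝ) + 1 ≤ 34 / ε := by
    have h1 := (Nat.ceil_lt_add_one (a := 32 / ε) (by positivity)).le
    have h2 : 1 ≤ 1 / ε := (one_le_div hε).2 hε1
    have e : 34 / ε = 32 / ε + 1 / ε + 1 / ε := by ring
    unfold numCandidates
    linarith
  set Q := numTrials ε
  set J := numCandidates ε
  set t := overlap D with ht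
  set τ := max t ε with hτdef
  -- Chosen between the two regimes: a good element has expected scores at least Qt/8, which is 4σ
  -- when τ = t, and one with a probability below τ/128 has an expected score below σ/4.
  set σ := Q * τ / 32 with hσ
  have hτ : 0 < τ := lt_max_of_lt_right hε
  have hσ0 : Q * ε / 32 ≤ σ := by
    rw [hσ]
    gcongr
    exact le_max_right _ _
  -- σ/2 ≥ 8(1 + log ε⁻¹), so the tail is at most e⁻⁸ε, which absorbs the union bound over at most
  -- 34/ε candidates.
  have hexp : (J + 1) * Real.exp (-(σ / 2)) ≤ 1 / 50 := by
    have h1 : Real.exp (-(σ / 2)) ≤ Real.exp (-8) * ε := by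
      rw [← Real.exp_log hε, ← Real.exp_add]
      refine Real.exp_le_exp.2 ?_
      rw [Real.log_inv] at hσε hl
      linarith
    have h8 : Real.exp (-8) ≤ 1 / 1700 := by
      rw [Real.exp_neg, inv_eq_one_div]
      refine one_div_le_one_div_of_le (by norm_num) ?_
      have h2 : (2.718 : ℝ) ≤ Real.exp 1 := by linarith [Real.exp_one_gt_d9]
      calc (1700 : ℝ) ≤ 2.718 ^ 8 := by norm_num
        _ ≤ Real.exp 1 ^ 8 := by gcongr
        _ = Real.exp 8 := by rw [← Real.exp_nat_mul]; norm_num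
    calc _ ≤ 34 / ε * (1 / 1700 * ε) := by
          gcongr
          exact h1.trans (by gcongr)
      _ = 1 / 50 := by field_simp; norm_num
  have hbad : (select Q J).fail D
      (fun w => σ ≤ w.2 → τ / 128 ≤ min (probSamp D w.1) (probUnif D w.1)) ≤ 1 / 50 := by
    refine (fail_select_le Q J).trans (le_trans ?_ hexp)
    refine mul_le_mul_of_nonneg_left (fail_candidate_le ?_) (by positivity)
    rw [hσ]
    linarith
  have himp : ∀ w : Fin N × ℝ, (t ≤ ε ∨ σ ≤ w.2) →
      (σ ≤ w.2 → τ / 128 ≤ min (probSamp D w.1) (probUnif D w.1)) →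
      (w.2 < Q * ε / 32 → t ≤ ε) ∧
        (Q * ε / 32 ≤ w.2 → τ / 128 ≤ min (probSamp D w.1) (probUnif D w.1)) := by
    rintro w (h | h) h2
    · refine ⟨fun _ => h, fun h3 => h2 ?_⟩
      rwa [hσ, hτdef, max_eq_right h]
    · exact ⟨fun h3 => absurd h3 (not_lt.2 (hσ0.trans h)), fun _ => h2 h⟩
  -- If t ≤ ε, output 1 is acceptable and only bad winners must be excluded. Otherwise τ = t, and
  -- some candidate must also reach σ: each fails with probability at most 1 - t/8, and there are
  -- more than 32/ε of them.
  rcases le_or_gt t ε with hcase | hcase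
  · refine (fail_mono fun w hw => himp w (Or.inl hcase) hw).trans (hbad.trans (by norm_num))
  · refine (fail_mono fun w (hw : σ ≤ w.2 ∧ _) => himp w (Or.inr hw.1) hw.2).trans
      (fail_and_le.trans (add_le_add ?_ hbad))
    have hτt : τ = t := max_eq_left hcase.le
    have hc := fail_candidate_score_le (D := D) (Q := Q) (σ := σ) (μ := t / 8) (by linarith)
      (by rw [hσ, hτt]; linarith) overlap_le_sum_good
    rw [fail_select_score]
    have h0 : 0 ≤ (candidate Q).fail D (fun w => σ ≤ w.2) :=
      expect_nonneg D _ fun x => by split_ifs <;> norm_num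
    have h1 : (candidate Q).fail D (fun w => σ ≤ w.2) ≤ Real.exp (-(t / 8)) :=
      hc.trans (by linarith [Real.add_one_le_exp (-(t / 8))])
    calc _ ≤ Real.exp (-(t / 8)) ^ (J + 1) := by gcongr
      _ = Real.exp (-((J + 1) * t / 8)) := by
        rw [← Real.exp_nat_mul]; congr 1; push_cast; ring
      _ ≤ Real.exp (-4) := by
        refine Real.exp_le_exp.2 ?_
        rw [div_le_iff₀ hε] at hJ
        have : J * ε ≤ J * t := by gcongr
        have : 0 ≤ t := overlap_nonneg
        linarith
      _ ≤ 1 / 50 := by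
        rw [Real.exp_neg, inv_eq_one_div]
        refine one_div_le_one_div_of_le (by norm_num) ?_
        have h2 : (2.718 : ℝ) ≤ Real.exp 1 := by linarith [Real.exp_one_gt_d9]
        calc (50 : ℝ) ≤ 2.718 ^ 4 := by norm_num
          _ ≤ Real.exp 1 ^ 4 := by gcongr
          _ = Real.exp 4 := by rw [← Real.exp_nat_mul]; norm_num

theorem fail_estimator_le [NeZero N] (hε : 0 < ε) (hε1 : ε ≤ 1) :
    (estimator ε).fail D (fun v => |v - (1 - overlap D)| ≤ ε) ≤ 1 / 3 := by
  -- Failure budget: 2/50 for the selection, 1/20 for each of the two success probabilities, 1/32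
  -- for the multilevel phase.
  refine (fail_bind_le (η := 1 / 20 + (1 / 20 + 1 / 32)) (ensures_select _ _)
    (fail_select_numTrials_le hε hε1) (by norm_num) fun w hw h => ?_).trans (by norm_num)
  split_ifs with hlt
  · refine (fail_output ?_).trans (by norm_num)
    have := h.1 hlt
    have h0 : 0 ≤ overlap D := overlap_nonneg
    rw [abs_le]
    constructor <;> linarith
  · exact fail_estimateWith_le hw hε (le_max_right _ _) (max_le overlap_le_one hε1)
      (le_max_left _ _) (h.2 (not_lt.1 hlt))

end Law

end CondAlg

/-- The tolerant uniformity tester. -/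
def tolerantUnif (N : ℕ) (ε : ℝ) : CondAlg N ℝ :=
  if h : N = 0 then .output 0 else haveI : NeZero N := ⟨h⟩; CondAlg.estimator ε

end

theorem theorem1 :
    ∃ (TolerantUnif : (N : ℕ) → (ε : ℝ) → CondAlg N ℝ) (C : ℝ) (k : ℕ),
      ∀ (N : ℕ) [NeZero N] (ε : ℝ), 0 < ε → ε ≤ 1 →
        (TolerantUnif N ε).IsPairCond ∧
        ((TolerantUnif N ε).queries : ℝ) ≤ C * (ε⁻¹ ^ 2 * (1 + Real.log ε⁻¹) ^ k) ∧
        ∀ D : PMF (Fin N),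
          (TolerantUnif N ε).Legal D ∧
          (2 / 3 : ℝ≥0∞) ≤ ((TolerantUnif N ε).run D).toMeasure
            {v : ℝ | |v - dTV D (PMF.uniformOfFintype (Fin N))| ≤ ε} := by
  refine ⟨tolerantUnif, 2 ^ 36, 2, fun N _ ε hε hε1 => ?_⟩
  have e : tolerantUnif N ε = CondAlg.estimator ε := dif_neg (NeZero.ne N)
  rw [e]
  refine ⟨CondAlg.isPairCond_estimator, CondAlg.queries_estimator_le hε hε1, fun D =>
    ⟨CondAlg.ensures_estimator.legal, ?_⟩⟩
  have hm : MeasurableSet {v : ℝ | |v - dTV D (PMF.uniformOfFintype (Fin N))| ≤ ε} :=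
    measurableSet_le (by fun_prop) measurable_const
  have h := CondAlg.fail_estimator_le (D := D) hε hε1
  rw [← CondAlg.dTV_uniform] at h
  refine le_trans (le_of_eq ?_) (CondAlg.toMeasure_run_ge hm h)
  rw [show (1 : ℝ) - 1 / 3 = 2 / 3 by norm_num, ENNReal.ofReal_div_of_pos (by norm_num)]
  norm_num
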